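/- Let $N\ge 1$ be an integer and $\hbar>0$. For a lower triangular array $\gamma=(\gamma_{nj})_{1\le j\le n\le N}$ of complex numbers with last row $\gamma_{Nj}=\lambda_j$, for $q\in\mathbb C^N$ and $c\in\{i\hbar,\hbar\}$, with principal powers $c^{z}=e^{z\log c}$, put $$ F_c(\gamma,q)=\exp\Big(-\frac1{i\hbar}\sum_{n=1}^{N}q_n\Big(\sum_{j=1}^{n}\gamma_{nj}-\sum_{j=1}^{n-1}\gamma_{n-1,j}\Big)\Big) \prod_{n=1}^{N-1}\frac{\prod_{j=1}^{n}\prod_{k=1}^{n+1}c^{\frac{\gamma_{nj}-\gamma_{n+1,k}}{i\hbar}}\,\Gamma\big(\frac{\gamma_{nj}-\gamma_{n+1,k}}{i\hbar}\big)}{\prod_{1\le j<k\le n}\Gamma\big(\frac{\gamma_{nj}-\gamma_{nk}}{i\hbar}\big)\Gamma\big(-\frac{\gamma_{nj}-\gamma_{nk}}{i\hbar}\big)}, $$ (the denominator is $\prod_{j<k}|\Gamma(\frac{\gamma_{nj}-\gamma_{nk}}{i\hbar})|^2$ when the differences $\gamma_{nj}-\gamma_{nk}$ are real), and $$w_c(\lambda,q)=\int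 F_c(\gamma,q)\prod_{1\le j\le n\le N-1}d\gamma_{nj},$$ where $\gamma_{nj}$ runs from left to right over a horizontal line $\mathrm{Im}\,\gamma_{nj}=a_{nj}$, and the lines are chosen so that $\mathrm{Im}\,\gamma_{nj}>\max_k\mathrm{Im}\,\gamma_{n+1,k}$ for all $1\le j\le n\le N-1$. For a function $f$ of $\lambda\in\mathbb C^N$ and $1\le k\le N$ let $$ (X^{(k)*}f)(\lambda)=\sum_{I\subseteq\{1,\dots,N\},\ |I|=k}\ \prod_{i\in I}\prod_{j\notin I}\frac1{\lambda_i-\lambda_j}\;(\mu_I^*f)(\lambda), $$ where $\mu_I^*$ is the shift $\lambda_i\to\lambda_i-i\hbar$ for all $i\in I$. (a) Let $q\in\mathbb C^N$ satisfy $|\mathrm{Im}(q_m-q_n)+\pi(m-n)|<\pi$ for all $m,n$. Then for every $\lambda\in\mathbb C^N$ and every choice of lines as above the integral $w_{i\hbar}(\lambda,q)$ converges absolutely, its value does not depend on the choice of lines, and for all $1\le k\le N$ and all $\lambda\in\mathbb C^N$ with pairwise distinct entries $$X^{(k)*}w_{i\hbar}(\lambda,q)=(-1)^{k(N-1)}\,e^{q_N+q_{N-1}+\cdots+q_{N-k+1}}\,w_{i\hbar}(\lambda,q).$$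 (b) Let $q\in\mathbb C^N$ satisfy $|\mathrm{Im}(q_m-q_n)|<\pi$ for all $m,n$; for instance, let $q$ be real. Then the same holds for the Kharchev–Lebedev integral $w_\hbar$, with the sign $(-1)^{k(N-1)}$ replaced by $i^{k(N-k)}$: $$X^{(k)*}w_{\hbar}(\lambda,q)=i^{k(N-k)}\,e^{q_N+q_{N-1}+\cdots+q_{N-k+1}}\,w_{\hbar}(\lambda,q).$$ -/

import Mathlib

open MeasureTheory

noncomputable section

namespace WhittakerDual

/-- Index set of the integration variables `γ_{nj}`, `1 ≤ j ≤ n < N` (row `n` has `n` entries,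
numbered from `0`; row `0` is empty). -/
abbrev Idx (N : ℕ) : Type := (n : Fin N) × Fin (n : ℕ)

/-- The triangular array `γ`: row `N` is `λ`, and for `n < N` the entry `γ_{nj}` has real part
`x_{nj}` and imaginary part `a_{nj}`. -/
def row {N : ℕ} (lam : Fin N → ℂ) (a x : Idx N → ℝ) (n : ℕ) (j : Fin n) : ℂ :=
  if h : n = N then lam (Fin.cast h j)
  else if h' : n < N then (x ⟨⟨n, h'⟩, j⟩ : ℂ) + (a ⟨⟨n, h'⟩, j⟩ : ℂ) * Complex.I
  else 0

/-- The horizontal lines `Im γ_{nj} = a_{nj}` form an admissible contour: every entry of row `n`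
lies strictly above every entry of row `n + 1`, where row `N` is `λ`. -/
def Admissible {N : ℕ} (lam : Fin N → ℂ) (a : Idx N → ℝ) : Prop :=
  ∀ (n : Fin N) (j : Fin (n : ℕ)) (k : Fin ((n : ℕ) + 1)),
    (row lam a 0 ((n : ℕ) + 1) k).im < (row lam a 0 (n : ℕ) j).im

/-- The Mellin--Barnes integrand at the triangular array `γ`, with powers `c ^ (…)` in front of the
Gamma functions. The product `Γ(z) Γ(-z)` in the denominator is `|Γ(z)|²` when `γ_{nj} - γ_{nk}` is
real, see `Gamma_mul_Gamma_neg_eq`. -/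
def integrand (c : ℂ) (hbar : ℝ) {N : ℕ} (q : Fin N → ℂ) (γ : (n : ℕ) → Fin n → ℂ) : ℂ :=
  Complex.exp (-(1 / (Complex.I * hbar)) *
      ∑ n : Fin N, q n * (∑ j, γ ((n : ℕ) + 1) j - ∑ j, γ (n : ℕ) j)) *
    ∏ n ∈ Finset.Ico 1 N,
      (∏ j : Fin n, ∏ k : Fin (n + 1),
          c ^ ((γ n j - γ (n + 1) k) / (Complex.I * hbar)) *
            Complex.Gamma ((γ n j - γ (n + 1) k) / (Complex.I * hbar))) /
        (∏ j : Fin n, ∏ k ∈ Finset.Ioi j,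
          Complex.Gamma ((γ n j - γ n k) / (Complex.I * hbar)) *
            Complex.Gamma (-((γ n j - γ n k) / (Complex.I * hbar))))

theorem Gamma_mul_Gamma_neg_eq (x hbar : ℝ) :
    Complex.Gamma ((x : ℂ) / (Complex.I * hbar)) * Complex.Gamma (-((x : ℂ) / (Complex.I * hbar))) =
      ((‖Complex.Gamma ((x : ℂ) / (Complex.I * hbar))‖ ^ 2 : ℝ) : ℂ) := by
  have h : -((x : ℂ) / (Complex.I * hbar)) =
      (starRingEnd ℂ) ((x : ℂ) / (Complex.I * hbar)) := by
    simp [map_div₀, div_neg]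
  rw [h, Complex.Gamma_conj, Complex.mul_conj, Complex.normSq_eq_norm_sq]

/-- The integrand on the contour `Im γ_{nj} = a_{nj}`, as a function of the real parts. -/
def lineIntegrand (c : ℂ) (hbar : ℝ) {N : ℕ} (lam : Fin N → ℂ) (q : Fin N → ℂ)
    (a x : Idx N → ℝ) : ℂ :=
  integrand c hbar q (row lam a x)

/-- A contour that is admissible for `λ`; all entries of a row have the same imaginary part. -/
def stdContour {N : ℕ} (lam : Fin N → ℂ) (p : Idx N) : ℝ :=
  (∑ k, |(lam k).im|) + ((N : ℝ) - (p.1 : ℕ))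

theorem stdContour_admissible {N : ℕ} (lam : Fin N → ℂ) : Admissible lam (stdContour lam) := by
  intro n j k
  have hn := n.isLt
  have h1 : ((n : ℕ)) ≠ N := hn.ne
  have hr : (row lam (stdContour lam) 0 (n : ℕ) j).im
      = (∑ k, |(lam k).im|) + ((N : ℝ) - (n : ℕ)) := by
    simp [row, h1, hn, stdContour]
  rw [hr]
  by_cases h : (n : ℕ) + 1 = N
  · have hk : (row lam (stdContour lam) 0 ((n : ℕ) + 1) k) = lam (Fin.cast h k) := by
      simp [row, h]
    have h3 : |(lam (Fin.cast h k)).im| ≤ ∑ k, |(lam k).im| :=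
      Finset.single_le_sum (f := fun k => |(lam k).im|) (fun _ _ => abs_nonneg _)
        (Finset.mem_univ _)
    have h4 := le_abs_self (lam (Fin.cast h k)).im
    have h5 : ((n : ℕ) : ℝ) + 1 = N := by exact_mod_cast h
    rw [hk]
    linarith
  · have h' : (n : ℕ) + 1 < N := by omega
    have hk : (row lam (stdContour lam) 0 ((n : ℕ) + 1) k).im
        = (∑ k, |(lam k).im|) + ((N : ℝ) - ((n : ℕ) + 1 : ℕ)) := by
      simp [row, h, h', stdContour]
    rw [hk]
    push_cast
    linarith

/-- The Mellin--Barnes function `w(λ, q)` with powers `c ^ (…)` in front of the Gamma functions. -/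
def whittaker (c : ℂ) (hbar : ℝ) {N : ℕ} (lam : Fin N → ℂ) (q : Fin N → ℂ) : ℂ :=
  ∫ x : Idx N → ℝ, lineIntegrand c hbar lam q (stdContour lam) x

/-- `S_I(λ) = ∏_{i ∈ I} ∏_{j ∉ I} 1 / (λ_i - λ_j)`. -/
def S {N : ℕ} (I : Finset (Fin N)) (lam : Fin N → ℂ) : ℂ :=
  ∏ i ∈ I, ∏ j ∈ Iᶜ, 1 / (lam i - lam j)

/-- The shift `μ*_I`, i.e. `λ_i → λ_i - iħ` for all `i ∈ I`, acting on functions of `λ`. -/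
def muStar (hbar : ℝ) {N : ℕ} (I : Finset (Fin N)) (f : (Fin N → ℂ) → ℂ) (lam : Fin N → ℂ) : ℂ :=
  f (fun i => if i ∈ I then lam i - Complex.I * hbar else lam i)

/-- The difference operator `X^{(k)*} = ∑_{|I| = k} S_I(λ) μ*_I`. -/
def Xstar (hbar : ℝ) {N : ℕ} (k : ℕ) (f : (Fin N → ℂ) → ℂ) (lam : Fin N → ℂ) : ℂ :=
  ∑ I ∈ Finset.powersetCard k (Finset.univ : Finset (Fin N)), S I lam * muStar hbar I f lam

end WhittakerDual

end

/-!
In the variables `z = γ / (iħ)` the powers of `c` only multiply the integrand by the exponential of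
a linear form, so they can be absorbed into `q` (`twist`, `integrand_eq_core`). Both parts become
statements about one integrand `core` with parameters `Q n` whose imaginary parts differ by less
than `π`.

*Convergence.* `Γ` decays like `exp (-(π / 2 - ε) |Im z|)` on vertical strips, by rotating the ray
in Euler's integral, and `1 / (Γ(u) Γ(-u)) = -u sin (π u) / π` is bounded by `exp (π |Im u|)` up to
a linear factor. The resulting exponent is a sum of absolute values of differences and of linear
terms. Written as an integral over levels, it becomes a quadratic form in the differences
`D n = A (n + 1) - A n`, where `A n` counts the entries of row `n` above the level; since the `D n`
are integers, it is bounded above by a negative multiple of the size of the array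
(`exists_exponent_le`).

*Independence of the contour.* The integral over a contour translated by a complex multiple `ζ` of
a real vector is holomorphic in `ζ` and constant for real `ζ` (`integral_onLine_eq`).

*Difference equation.* Applying the operator to `core` produces the factor
`∑ I, ∏ 1 / (x i - x j) ∏ (x i - y j)`, where `x` is the top row and `y` the row below it. By a
duality of rational functions (`upperSum_eq_lowerSum`) this is a sum over subsets `J` of the row `y`
with one element less. Translating the contour of `y` by one unit in the entries `J` turns it into
the same kind of factor for `y` and the next row (`lowerTerm_mul_core_shiftRow`), and contributes
the exponential of a difference of two of the `Q n`. After `k` such steps the factor is `1` and the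
exponentials have combined to the eigenvalue (`Spaced.integral_sum_upperTerm`). All contours in this
argument keep the entries of a row apart, so that the cancelled poles are never met.
-/

noncomputable section

namespace WhittakerDual

/-! ### Integrals depending holomorphically on a parameter -/

/-- A dominated integral of functions that are holomorphic in a parameter is holomorphic in that
parameter; the derivatives are dominated because of Cauchy's estimate. -/
theorem differentiableOn_integral_of_dominated {α : Type*} [MeasurableSpace α] {μ : Measure α}
    {F : ℂ → α → ℂ} {U : Set ℂ} (hU : IsOpen U) {g : α → ℝ}
    (hmeas : ∀ ζ ∈ U, AEStronglyMeasurable (F ζ) μ)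
    (hdiff : ∀ᵐ x ∂μ, DifferentiableOn ℂ (fun ζ => F ζ x) U)
    (hbound : ∀ᵐ x ∂μ, ∀ ζ ∈ U, ‖F ζ x‖ ≤ g x) (hg : Integrable g μ) :
    DifferentiableOn ℂ (fun ζ => ∫ x, F ζ x ∂μ) U := by
  intro ζ₀ hζ₀
  obtain ⟨r, hr, hball⟩ := Metric.isOpen_iff.1 hU ζ₀ hζ₀
  have hsub : ∀ ζ ∈ Metric.ball ζ₀ (r / 2), Metric.closedBall ζ (r / 3) ⊆ U := by
    intro ζ hζ w hw
    apply hball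
    rw [Metric.mem_ball] at hζ ⊢
    rw [Metric.mem_closedBall] at hw
    have := dist_triangle w ζ ζ₀
    linarith
  have hmeas' : AEStronglyMeasurable (fun x => deriv (fun ζ => F ζ x) ζ₀) μ := by
    -- the derivative is a limit of difference quotients along a sequence in `U`
    obtain ⟨N, hN⟩ := exists_nat_gt (1 / r)
    have hin : ∀ n : ℕ, ζ₀ + ((1 / ((n : ℝ) + 1 + N) : ℝ) : ℂ) ∈ U := by
      intro n
      apply hball
      rw [Metric.mem_ball, dist_eq_norm, add_sub_cancel_left, Complex.norm_real, Real.norm_eq_abs,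
        abs_of_pos (by positivity), div_lt_comm₀ (by positivity) hr]
      have : (0 : ℝ) ≤ n := n.cast_nonneg
      linarith
    have hlim : Filter.Tendsto (fun n : ℕ => ζ₀ + ((1 / ((n : ℝ) + 1 + N) : ℝ) : ℂ)) Filter.atTop
        (nhdsWithin ζ₀ {ζ₀}ᶜ) := by
      apply tendsto_nhdsWithin_of_tendsto_nhds_of_eventually_within
      · have h1 : Filter.Tendsto (fun n : ℕ => 1 / ((n : ℝ) + 1 + N)) Filter.atTop (nhds 0) := by
          have := (tendsto_one_div_add_atTop_nhds_zero_nat (𝕜 := ℝ)).comp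
            (Filter.tendsto_add_atTop_nat N)
          refine this.congr fun n => ?_
          simp only [Function.comp, Nat.cast_add]
          ring
        have h2 := (Complex.continuous_ofReal.tendsto 0).comp h1
        have h3 := h2.const_add ζ₀
        simpa using h3
      · refine Filter.Eventually.of_forall fun n => ?_
        have : (0 : ℝ) < 1 / ((n : ℝ) + 1 + N) := by positivity
        simp only [Set.mem_compl_iff, Set.mem_singleton_iff, add_eq_left]
        exact_mod_cast this.ne'
    refine aestronglyMeasurable_of_tendsto_ae Filter.atTop
      (f := fun (n : ℕ) x => slope (fun ζ => F ζ x) ζ₀ (ζ₀ + ((1 / ((n : ℝ) + 1 + N) : ℝ) : ℂ)))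
      (fun n => ?_) ?_
    · simp only [slope, vsub_eq_sub, smul_eq_mul]
      exact ((hmeas _ (hin n)).sub (hmeas _ hζ₀)).const_mul _
    · filter_upwards [hdiff] with x hx
      have h1 := ((hx ζ₀ hζ₀).differentiableAt (hU.mem_nhds hζ₀)).hasDerivAt
      exact (hasDerivAt_iff_tendsto_slope.1 h1).comp hlim
  refine (hasDerivAt_integral_of_dominated_loc_of_deriv_le
    (F' := fun ζ x => deriv (fun ζ => F ζ x) ζ) (bound := fun x => g x / (r / 3))
    (Metric.ball_mem_nhds ζ₀ (half_pos hr)) ?_ ?_ hmeas' ?_ (hg.div_const _) ?_).2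
    |>.differentiableAt.differentiableWithinAt
  · filter_upwards [hU.mem_nhds hζ₀] with ζ hζ using hmeas ζ hζ
  · refine hg.mono' (hmeas _ hζ₀) ?_
    filter_upwards [hbound] with x hx using hx _ hζ₀
  · filter_upwards [hbound, hdiff] with x hx hd ζ hζ
    refine Complex.norm_deriv_le_of_forall_mem_sphere_norm_le (by positivity) ?_ ?_
    · apply DifferentiableOn.diffContOnCl
      rw [closure_ball _ (by positivity)]
      exact hd.mono (hsub ζ hζ)
    · intro w hw
      exact hx w (hsub ζ hζ (Metric.sphere_subset_closedBall hw))
  · filter_upwards [hdiff] with x hd ζ hζ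
    have hζU : ζ ∈ U := hsub ζ hζ (Metric.mem_closedBall_self (by positivity))
    exact ((hd ζ hζU).differentiableAt (hU.mem_nhds hζU)).hasDerivAt

/-- Two holomorphic functions on a convex open set that agree at its real points agree, as soon as
the set contains one real point. -/
theorem eqOn_of_eq_real {U : Set ℂ} (hU : IsOpen U) (hc : Convex ℝ U) {F G : ℂ → ℂ}
    (hF : DifferentiableOn ℂ F U) (hG : DifferentiableOn ℂ G U) {r₀ : ℝ} (hr₀ : (r₀ : ℂ) ∈ U)
    (h : ∀ r : ℝ, (r : ℂ) ∈ U → F r = G r) : Set.EqOn F G U := by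
  refine (hF.analyticOnNhd hU).eqOn_of_preconnected_of_frequently_eq (hG.analyticOnNhd hU)
    hc.isPreconnected hr₀ ?_
  have hlim : Filter.Tendsto (fun r : ℝ => (r : ℂ)) (nhdsWithin r₀ {r₀}ᶜ)
      (nhdsWithin (r₀ : ℂ) {(r₀ : ℂ)}ᶜ) := by
    apply tendsto_nhdsWithin_of_tendsto_nhds_of_eventually_within
    · exact (Complex.continuous_ofReal.tendsto r₀).mono_left nhdsWithin_le_nhds
    · filter_upwards [self_mem_nhdsWithin] with r hr
      simpa using hr
  refine hlim.frequently (Filter.Eventually.frequently ?_)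
  have h2 : ∀ᶠ r : ℝ in nhdsWithin r₀ {r₀}ᶜ, (r : ℂ) ∈ U :=
    ((Complex.continuous_ofReal.tendsto r₀).mono_left nhdsWithin_le_nhds).eventually
      (hU.mem_nhds hr₀)
  filter_upwards [h2] with r hr using h r hr

/-! ### Moving a product of horizontal lines -/

theorem integrable_exp_neg_mul_abs {c : ℝ} (hc : 0 < c) :
    Integrable (fun x : ℝ => Real.exp (-c * |x|)) := by
  have h := (integrableOn_exp_mul_Iic (a := c) hc 0)
  rw [← integrableOn_univ, ← Set.Iic_union_Ioi (a := (0 : ℝ))]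
  refine IntegrableOn.union ?_ ?_
  · refine h.congr_fun (fun x hx => ?_) measurableSet_Iic
    simp only [abs_of_nonpos (Set.mem_Iic.1 hx)]
    ring_nf
  · refine (exp_neg_integrableOn_Ioi 0 hc).congr_fun (fun x hx => ?_) measurableSet_Ioi
    simp only [abs_of_pos (Set.mem_Ioi.1 hx)]

theorem integrable_exp_neg_mul_sum_abs {ι : Type*} [Fintype ι] {c : ℝ} (hc : 0 < c) :
    Integrable (fun x : ι → ℝ => Real.exp (-c * ∑ p, |x p|)) := by
  simp only [Finset.mul_sum, Real.exp_sum]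
  exact Integrable.fintype_prod (f := fun _ : ι => fun x : ℝ => Real.exp (-c * |x|))
    fun _ => integrable_exp_neg_mul_abs hc

/-- The tube over a set `s` of imaginary parts. -/
def tube {ι : Type*} (s : Set (ι → ℝ)) : Set (ι → ℂ) := {w | (fun p => (w p).im) ∈ s}

/-- The point of the horizontal contour with imaginary parts `a` and real parts `x`. -/
def onLine {ι : Type*} (a x : ι → ℝ) (p : ι) : ℂ := x p + a p * Complex.I

theorem onLine_mem_tube {ι : Type*} {s : Set (ι → ℝ)} {a : ι → ℝ} (ha : a ∈ s) (x : ι → ℝ) :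
    onLine a x ∈ tube s := by
  simpa [tube, onLine] using ha

/-- A function on a tube decays exponentially in the real directions. -/
def ExpDecay {ι : Type*} [Fintype ι] (s : Set (ι → ℝ)) (f : (ι → ℂ) → ℂ) : Prop :=
  ∃ C c : ℝ, 0 < c ∧ ∀ w ∈ tube s, ‖f w‖ ≤ C * Real.exp (-c * ∑ p, |(w p).re|)

theorem integrable_onLine {ι : Type*} [Fintype ι] {s : Set (ι → ℝ)} {f : (ι → ℂ) → ℂ}
    (hf : ContinuousOn f (tube s)) (hd : ExpDecay s f) {a : ι → ℝ} (ha : a ∈ s) :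
    Integrable (fun x => f (onLine a x)) := by
  obtain ⟨C, c, hc, hb⟩ := hd
  refine ((integrable_exp_neg_mul_sum_abs hc).const_mul C).mono' ?_ ?_
  · refine Continuous.aestronglyMeasurable ?_
    refine hf.comp_continuous ?_ (fun x => onLine_mem_tube ha x)
    unfold onLine
    fun_prop
  · refine Filter.Eventually.of_forall fun x => ?_
    simpa [onLine] using hb _ (onLine_mem_tube ha x)

/-- Cauchy's theorem for a product of horizontal lines. The integral over the contour moved by
`ζ (b - a)` with complex `ζ` is holomorphic in `ζ` and, by translation invariance, constant for
real `ζ`; hence it has the same value at `0` and at `i`. -/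
theorem integral_onLine_eq {ι : Type*} [Fintype ι] {s : Set (ι → ℝ)} (hs : IsOpen s)
    (hconv : Convex ℝ s) {f : (ι → ℂ) → ℂ} (hf : DifferentiableOn ℂ f (tube s))
    (hd : ExpDecay s f) {a b : ι → ℝ} (ha : a ∈ s) (hb : b ∈ s) :
    ∫ x, f (onLine a x) = ∫ x, f (onLine b x) := by
  obtain ⟨C, c, hc, hbd⟩ := hd
  set v : ι → ℝ := b - a with hv
  let W : ℂ → (ι → ℝ) → (ι → ℂ) := fun ζ x p => onLine a x p + ζ * v p
  let U : Set ℂ := {ζ | |ζ.re| < 1 ∧ a + ζ.im • v ∈ s}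
  have hU : IsOpen U := by
    refine IsOpen.and (isOpen_lt (by fun_prop) continuous_const) ?_
    exact hs.preimage (by fun_prop)
  have hUc : Convex ℝ U := by
    intro z hz w hw t u ht hu htu
    refine ⟨?_, ?_⟩
    · have h1 : |t * z.re + u * w.re| ≤ t * |z.re| + u * |w.re| := by
        refine (abs_add_le _ _).trans_eq ?_
        rw [abs_mul, abs_mul, abs_of_nonneg ht, abs_of_nonneg hu]
      have h2 : (t • z + u • w).re = t * z.re + u * w.re := by simp
      rw [h2]
      have h3 := (convex_Iio (1 : ℝ)) (Set.mem_Iio.2 hz.1) (Set.mem_Iio.2 hw.1) ht hu htu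
      simp only [smul_eq_mul, Set.mem_Iio] at h3
      linarith
    · have h2 : a + (t • z + u • w).im • v = t • (a + z.im • v) + u • (a + w.im • v) := by
        ext p
        have : u = 1 - t := by linarith
        subst this
        simp
        ring
      rw [h2]
      exact hconv hz.2 hw.2 ht hu htu
  have hW : ∀ ζ ∈ U, ∀ x, W ζ x ∈ tube s := by
    intro ζ hζ x
    have h2 : (fun p => (W ζ x p).im) = a + ζ.im • v := by
      ext p
      simp [W, onLine]
    change (fun p => (W ζ x p).im) ∈ s
    rw [h2]
    exact hζ.2
  have h0 : (0 : ℂ) ∈ U := by simp [U, ha]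
  have hI : Complex.I ∈ U := by simp [U, hv, hb]
  have hdiff : DifferentiableOn ℂ (fun ζ => ∫ x, f (W ζ x)) U := by
    refine differentiableOn_integral_of_dominated hU
      (g := fun x => C * Real.exp (c * ∑ p, |v p|) * Real.exp (-c * ∑ p, |x p|)) ?_ ?_ ?_
      ((integrable_exp_neg_mul_sum_abs hc).const_mul _)
    · intro ζ hζ
      refine Continuous.aestronglyMeasurable ?_
      refine hf.continuousOn.comp_continuous ?_ (hW ζ hζ)
      simp only [W, onLine]
      fun_prop
    · refine Filter.Eventually.of_forall fun x => ?_
      refine hf.comp (t := tube s) (f := fun ζ => W ζ x) ?_ (fun ζ hζ => hW ζ hζ x)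
      refine Differentiable.differentiableOn ?_
      simp only [W, onLine]
      fun_prop
    · refine Filter.Eventually.of_forall fun x ζ hζ => ?_
      have h1 := hbd _ (hW ζ hζ x)
      have hC : 0 ≤ C := by
        have := (norm_nonneg _).trans h1
        exact nonneg_of_mul_nonneg_left this (Real.exp_pos _)
      refine h1.trans ?_
      rw [mul_assoc, ← Real.exp_add]
      refine mul_le_mul_of_nonneg_left (Real.exp_le_exp.2 ?_) hC
      have h2 : ∑ p, |x p| ≤ ∑ p, |(W ζ x p).re| + ∑ p, |v p| := by
        rw [← Finset.sum_add_distrib]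
        refine Finset.sum_le_sum fun p _ => ?_
        have h3 : (W ζ x p).re = x p + ζ.re * v p := by simp [W, onLine]
        have h4 : |ζ.re * v p| ≤ |v p| := by
          rw [abs_mul]
          exact mul_le_of_le_one_left (abs_nonneg _) hζ.1.le
        have h5 : |x p| ≤ |x p + ζ.re * v p| + |ζ.re * v p| := by
          have := abs_sub (x p + ζ.re * v p) (ζ.re * v p)
          simpa using this
        rw [h3]
        linarith
      nlinarith
  have hconst := eqOn_of_eq_real hU hUc hdiff
    (differentiableOn_const (c := ∫ x, f (onLine a x))) (r₀ := 0) (by simpa using h0) ?_ hI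
  · have h1 : ∀ x, W Complex.I x = onLine b x := by
      intro x
      ext p
      simp only [W, onLine, hv, Pi.sub_apply]
      push_cast
      ring
    simp only [h1] at hconst
    exact hconst.symm
  · intro r _
    have h1 : ∀ x, W r x = onLine a (x + r • v) := by
      intro x
      ext p
      simp only [W, onLine, Pi.add_apply, Pi.smul_apply, smul_eq_mul]
      push_cast
      ring
    simp only [h1]
    exact integral_add_right_eq_self (fun x => f (onLine a x)) (r • v)

/-! ### Exponential decay of the Gamma function on vertical lines -/

/-- Euler's integral with a complex rate `r`, obtained from real rates by analytic continuation. -/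
theorem integral_cpow_mul_exp_neg_mul {z : ℂ} (hz : 0 < z.re) {r : ℂ} (hr : 0 < r.re) :
    ∫ t : ℝ in Set.Ioi 0, (t : ℂ) ^ (z - 1) * Complex.exp (-(r * t)) =
      (1 / r) ^ z * Complex.Gamma z := by
  set c := min (r.re / 2) (1 / 2) with hc
  have hc0 : 0 < c := by positivity
  have hU : IsOpen {r : ℂ | c < r.re} := isOpen_lt continuous_const Complex.continuous_re
  have hUc : Convex ℝ {r : ℂ | c < r.re} := convex_halfSpace_re_gt c
  have hpos : ∀ r ∈ {r : ℂ | c < r.re}, r ≠ 0 := by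
    rintro r hr rfl
    simp only [Set.mem_ofPred_eq, Complex.zero_re] at hr
    linarith
  refine eqOn_of_eq_real (F := fun r => ∫ t : ℝ in Set.Ioi 0, (t : ℂ) ^ (z - 1) *
    Complex.exp (-(r * t))) (G := fun r => (1 / r) ^ z * Complex.Gamma z) hU hUc ?_ ?_ (r₀ := 1)
    ?_ ?_ ?_
  · have hexp : IntegrableOn (fun t : ℝ => t ^ (z.re - 1) * Real.exp (-c * t)) (Set.Ioi 0) := by
      have := integrableOn_rpow_mul_exp_neg_mul_rpow (s := z.re - 1) (p := 1) (b := c)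
        (by linarith) one_pos hc0
      simpa using this
    refine differentiableOn_integral_of_dominated hU
      (g := fun t => t ^ (z.re - 1) * Real.exp (-c * t)) ?_ ?_ ?_ hexp
    · intro ζ _
      refine ContinuousOn.aestronglyMeasurable ?_ measurableSet_Ioi
      refine ContinuousOn.mul ?_ (by fun_prop)
      intro t ht
      exact ((continuousAt_cpow_const (Complex.ofReal_mem_slitPlane.2 ht)).comp
        Complex.continuous_ofReal.continuousAt).continuousWithinAt
    · refine Filter.Eventually.of_forall fun t => ?_
      fun_prop
    · filter_upwards [ae_restrict_mem measurableSet_Ioi] with t ht ζ hζ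
      have ht : (0 : ℝ) < t := ht
      have hζ : c < ζ.re := hζ
      rw [norm_mul, Complex.norm_cpow_eq_rpow_re_of_pos ht, Complex.norm_exp]
      have h1 : (-(ζ * t)).re = -ζ.re * t := by simp
      rw [h1, Complex.sub_re, Complex.one_re]
      gcongr
  · intro r hr
    have h0 : r ≠ 0 := hpos r hr
    have : (1 / r) ∈ Complex.slitPlane := by
      left
      rw [one_div, Complex.inv_re]
      have : 0 < r.re := hc0.trans hr
      have := Complex.normSq_pos.2 h0
      positivity
    refine DifferentiableAt.differentiableWithinAt ?_
    refine DifferentiableAt.mul ?_ (differentiableAt_const _)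
    refine DifferentiableAt.cpow ?_ (differentiableAt_const _) this
    exact (differentiableAt_const _).div differentiableAt_id h0
  · have : c ≤ 1 / 2 := min_le_right _ _
    simp only [Set.mem_ofPred_eq, Complex.ofReal_one, Complex.one_re]
    linarith
  · intro r hr
    have h0 : 0 < r := by
      simp only [Set.mem_ofPred_eq, Complex.ofReal_re] at hr
      linarith
    exact Complex.integral_cpow_mul_exp_neg_mul_Ioi hz h0
  · have : c ≤ r.re / 2 := min_le_left _ _
    simp only [Set.mem_ofPred_eq]
    linarith

/-- Rotating the ray of integration in Euler's integral by the angle `φ` gives the factor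
`exp (-φ Im z)`. -/
theorem norm_Gamma_le_exp_mul {z : ℂ} (hz : 0 < z.re) {φ : ℝ} (hφ : |φ| < Real.pi / 2) :
    ‖Complex.Gamma z‖ ≤
      Real.exp (-φ * z.im) * ((1 / Real.cos φ) ^ z.re * Real.Gamma z.re) := by
  have hcos : 0 < Real.cos φ := Real.cos_pos_of_mem_Ioo (abs_lt.1 hφ)
  set r := Complex.exp (φ * Complex.I) with hr
  have hre : r.re = Real.cos φ := by rw [hr, Complex.exp_ofReal_mul_I_re]
  have h1 := integral_cpow_mul_exp_neg_mul hz (r := r) (by rwa [hre])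
  have h2 : (1 / r) ^ z = Complex.exp (-(φ * Complex.I * z)) := by
    have : 1 / r = Complex.exp (-(φ * Complex.I)) := by
      rw [hr, one_div, ← Complex.exp_neg]
    have hφ' := abs_lt.1 hφ
    have him : (-(φ * Complex.I)).im = -φ := by simp
    rw [this, Complex.cpow_def_of_ne_zero (Complex.exp_ne_zero _), Complex.log_exp]
    · ring_nf
    · rw [him]
      linarith [Real.pi_pos]
    · rw [him]
      linarith [Real.pi_pos]
  have h3 : ‖∫ t : ℝ in Set.Ioi 0, (t : ℂ) ^ (z - 1) * Complex.exp (-(r * t))‖ ≤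
      (1 / Real.cos φ) ^ z.re * Real.Gamma z.re := by
    rw [← Real.integral_rpow_mul_exp_neg_mul_Ioi hz hcos]
    refine (norm_integral_le_integral_norm _).trans_eq ?_
    refine setIntegral_congr_fun measurableSet_Ioi fun t ht => ?_
    have ht : (0 : ℝ) < t := ht
    simp only [norm_mul]
    rw [Complex.norm_cpow_eq_rpow_re_of_pos ht, Complex.norm_exp]
    have h1 : (-(r * t)).re = -(Real.cos φ * t) := by simp [hre]
    rw [h1, Complex.sub_re, Complex.one_re]
  have h4 : Complex.Gamma z = Complex.exp (φ * Complex.I * z) *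
      ∫ t : ℝ in Set.Ioi 0, (t : ℂ) ^ (z - 1) * Complex.exp (-(r * t)) := by
    rw [h1, h2, ← mul_assoc, ← Complex.exp_add]
    simp
  have h5 : ‖Complex.exp (φ * Complex.I * z)‖ = Real.exp (-φ * z.im) := by
    rw [Complex.norm_exp]
    congr 1
    simp
  rw [h4, norm_mul, h5]
  exact mul_le_mul_of_nonneg_left h3 (Real.exp_pos _).le

/-- On a vertical strip in the right half plane, `Γ` decays like `exp (-φ |Im z|)` for every
`φ < π / 2`. -/
theorem exists_norm_Gamma_le (δ M : ℝ) (hδ : 0 < δ) {φ : ℝ} (h0 : 0 ≤ φ)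
    (hφ : φ < Real.pi / 2) :
    ∃ C : ℝ, 0 ≤ C ∧ ∀ z : ℂ, δ ≤ z.re → z.re ≤ M →
      ‖Complex.Gamma z‖ ≤ C * Real.exp (-φ * |z.im|) := by
  have hcos : 0 < Real.cos φ := Real.cos_pos_of_mem_Ioo ⟨by linarith, hφ⟩
  have hcont : ContinuousOn (fun σ : ℝ => (1 / Real.cos φ) ^ σ * Real.Gamma σ) (Set.Icc δ M) := by
    intro σ hσ
    have hσ0 : 0 < σ := hδ.trans_le hσ.1
    refine ContinuousAt.continuousWithinAt (ContinuousAt.mul ?_ ?_)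
    · exact (Real.continuous_const_rpow (by positivity)).continuousAt
    · refine (Real.differentiableAt_Gamma fun m => ?_).continuousAt
      have : (0 : ℝ) ≤ m := m.cast_nonneg
      linarith
  obtain ⟨C, hC⟩ := isCompact_Icc.exists_bound_of_continuousOn hcont
  refine ⟨max C 0, le_max_right _ _, fun z h1 h2 => ?_⟩
  have hz : 0 < z.re := hδ.trans_le h1
  have hb : (1 / Real.cos φ) ^ z.re * Real.Gamma z.re ≤ max C 0 :=
    (le_abs_self _).trans ((hC z.re ⟨h1, h2⟩).trans (le_max_left _ _))
  rw [mul_comm (max C 0)]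
  rcases le_total 0 z.im with him | him
  · refine (norm_Gamma_le_exp_mul hz (φ := φ) (by rwa [abs_of_nonneg h0])).trans ?_
    rw [abs_of_nonneg him]
    gcongr
  · refine (norm_Gamma_le_exp_mul hz (φ := -φ) (by rwa [abs_neg, abs_of_nonneg h0])).trans ?_
    rw [abs_of_nonpos him, Real.cos_neg]
    have : - -φ * z.im = -φ * -z.im := by ring
    rw [this]
    gcongr

/-! ### Exponential type up to arbitrarily small losses -/

section ExpType

variable {ι : Type*} [Fintype ι] {T : Set (ι → ℂ)} {f g u : (ι → ℂ) → ℂ} {ψ χ : (ι → ℂ) → ℝ}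

/-- `f = O(exp (ψ + η ∑ |Re w|))` on `T` for every `η > 0`. In this scale polynomial factors and
the missing `ε` in the decay rate `π / 2 - ε` of `Γ` do not matter. -/
def ExpType (T : Set (ι → ℂ)) (f : (ι → ℂ) → ℂ) (ψ : (ι → ℂ) → ℝ) : Prop :=
  ∀ η : ℝ, 0 < η → ∃ C : ℝ, 0 ≤ C ∧
    ∀ w ∈ T, ‖f w‖ ≤ C * Real.exp (ψ w + η * ∑ p, |(w p).re|)

/-- `f` grows at most linearly in the real directions, on `T`. -/
def LinGrowth (T : Set (ι → ℂ)) (f : (ι → ℂ) → ℂ) : Prop :=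
  ∃ L : ℝ, 0 < L ∧ ∀ w ∈ T, ‖f w‖ ≤ L * (1 + ∑ p, |(w p).re|)

theorem ExpType.mul (hf : ExpType T f ψ) (hg : ExpType T g χ) :
    ExpType T (fun w => f w * g w) (fun w => ψ w + χ w) := by
  intro η hη
  obtain ⟨C, hC, h1⟩ := hf (η / 2) (half_pos hη)
  obtain ⟨D, hD, h2⟩ := hg (η / 2) (half_pos hη)
  refine ⟨C * D, mul_nonneg hC hD, fun w hw => ?_⟩
  rw [norm_mul]
  refine (mul_le_mul (h1 w hw) (h2 w hw) (norm_nonneg _) (by positivity)).trans_eq ?_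
  rw [mul_mul_mul_comm, ← Real.exp_add]
  ring_nf

theorem ExpType.of_bound {C : ℝ} (h : ∀ w ∈ T, ‖f w‖ ≤ C) : ExpType T f (fun _ => 0) := by
  intro η hη
  refine ⟨max C 0, le_max_right _ _, fun w hw => ?_⟩
  refine ((h w hw).trans (le_max_left C 0)).trans ?_
  have h1 : (1 : ℝ) ≤ Real.exp (0 + η * ∑ p, |(w p).re|) := by
    apply Real.one_le_exp
    rw [zero_add]
    exact mul_nonneg hη.le (Finset.sum_nonneg fun _ _ => abs_nonneg _)
  exact le_mul_of_one_le_right (le_max_right _ _) h1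

theorem ExpType.prod {κ : Type*} (s : Finset κ) {F : κ → (ι → ℂ) → ℂ} {Ψ : κ → (ι → ℂ) → ℝ}
    (h : ∀ i ∈ s, ExpType T (F i) (Ψ i)) :
    ExpType T (fun w => ∏ i ∈ s, F i w) (fun w => ∑ i ∈ s, Ψ i w) := by
  classical
  induction s using Finset.induction_on with
  | empty => simpa using ExpType.of_bound (C := 1) (by simp)
  | insert a s ha ih =>
    simp only [Finset.prod_insert ha, Finset.sum_insert ha]
    exact (h a (Finset.mem_insert_self _ _)).mul
      (ih fun i hi => h i (Finset.mem_insert_of_mem hi))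

theorem LinGrowth.expType (h : LinGrowth T f) : ExpType T f (fun _ => 0) := by
  obtain ⟨L, hL, h⟩ := h
  intro η hη
  refine ⟨L * (1 + 1 / η), by positivity, fun w hw => (h w hw).trans ?_⟩
  rw [mul_assoc]
  refine mul_le_mul_of_nonneg_left ?_ hL.le
  have hν : 0 ≤ ∑ p, |(w p).re| := Finset.sum_nonneg fun _ _ => abs_nonneg _
  generalize ∑ p, |(w p).re| = ν at hν
  have h1 : 1 + η * ν ≤ Real.exp (0 + η * ν) := by
    rw [zero_add, add_comm]
    exact Real.add_one_le_exp _
  refine le_trans ?_ (mul_le_mul_of_nonneg_left h1 (by positivity))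
  have h2 : (1 + 1 / η) * (1 + η * ν) = 1 + ν + (η * ν + 1 / η) := by
    field_simp
    ring
  rw [h2]
  have : 0 ≤ η * ν + 1 / η := by positivity
  linarith

theorem LinGrowth.expType_Gamma (hu : LinGrowth T u) {δ M : ℝ} (hδ : 0 < δ)
    (hre : ∀ w ∈ T, δ ≤ (u w).re ∧ (u w).re ≤ M) :
    ExpType T (fun w => Complex.Gamma (u w)) (fun w => -(Real.pi / 2) * |(u w).im|) := by
  obtain ⟨L, hL, hu⟩ := hu
  intro η hη
  -- the loss `ε |Im u|` is at most `η (1 + ∑ |Re w|)` if `ε L ≤ η`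
  set ε := min (η / L) (Real.pi / 2) with hε
  have hε0 : 0 < ε := by positivity
  have hεL : ε * L ≤ η := by
    rw [← le_div_iff₀ hL]
    exact min_le_left _ _
  have hεp : ε ≤ Real.pi / 2 := min_le_right _ _
  obtain ⟨C, hC, hb⟩ := exists_norm_Gamma_le δ M hδ (φ := Real.pi / 2 - ε) (by linarith)
    (by linarith)
  refine ⟨C * Real.exp η, by positivity, fun w hw => ?_⟩
  refine (hb _ (hre w hw).1 (hre w hw).2).trans ?_
  rw [mul_assoc, ← Real.exp_add]
  refine mul_le_mul_of_nonneg_left (Real.exp_le_exp.2 ?_) hC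
  have hν : 0 ≤ ∑ p, |(w p).re| := Finset.sum_nonneg fun _ _ => abs_nonneg _
  have h1 := (Complex.abs_im_le_norm _).trans (hu w hw)
  have h2 : ε * |(u w).im| ≤ η * (1 + ∑ p, |(w p).re|) := by
    refine (mul_le_mul_of_nonneg_left h1 hε0.le).trans ?_
    rw [← mul_assoc]
    exact mul_le_mul_of_nonneg_right hεL (by positivity)
  linarith

theorem norm_sin_le_exp (z : ℂ) : ‖Complex.sin z‖ ≤ Real.exp |z.im| := by
  have h1 : ‖Complex.exp (-z * Complex.I)‖ ≤ Real.exp |z.im| := by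
    rw [Complex.norm_exp]
    exact Real.exp_le_exp.2 (by simpa using le_abs_self z.im)
  have h2 : ‖Complex.exp (z * Complex.I)‖ ≤ Real.exp |z.im| := by
    rw [Complex.norm_exp]
    exact Real.exp_le_exp.2 (by simpa using neg_le_abs z.im)
  rw [Complex.sin, norm_div, norm_mul, Complex.norm_I, mul_one, Complex.norm_ofNat]
  have := norm_sub_le (Complex.exp (-z * Complex.I)) (Complex.exp (z * Complex.I))
  linarith

theorem LinGrowth.expType_sin (hu : LinGrowth T u) :
    ExpType T (fun w => -(u w * Complex.sin (Real.pi * u w) / Real.pi))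
      (fun w => Real.pi * |(u w).im|) := by
  have h1 : ExpType T (fun w => Complex.sin (Real.pi * u w))
      (fun w => Real.pi * |(u w).im|) := by
    intro η hη
    refine ⟨1, zero_le_one, fun w _ => ?_⟩
    rw [one_mul]
    refine (norm_sin_le_exp _).trans (Real.exp_le_exp.2 ?_)
    have h2 : ((Real.pi : ℂ) * u w).im = Real.pi * (u w).im := by simp
    rw [h2, abs_mul, abs_of_pos Real.pi_pos, le_add_iff_nonneg_right]
    exact mul_nonneg hη.le (Finset.sum_nonneg fun _ _ => abs_nonneg _)
  have h2 := (hu.expType.mul h1).mul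
    (ExpType.of_bound (T := T) (f := fun _ => -(1 / (Real.pi : ℂ))) (C := ‖(1 / (Real.pi : ℂ))‖)
      (by simp))
  have e1 : (fun w => -(u w * Complex.sin (Real.pi * u w) / Real.pi)) =
      fun w => u w * Complex.sin (Real.pi * u w) * -(1 / (Real.pi : ℂ)) := by
    funext w
    ring
  rw [e1]
  simpa using h2

theorem expType_exp : ExpType T (fun w => Complex.exp (f w)) (fun w => (f w).re) := by
  intro η hη
  refine ⟨1, zero_le_one, fun w _ => ?_⟩
  rw [one_mul, Complex.norm_exp]
  refine Real.exp_le_exp.2 ?_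
  rw [le_add_iff_nonneg_right]
  exact mul_nonneg hη.le (Finset.sum_nonneg fun _ _ => abs_nonneg _)

theorem ExpType.expDecay {s : Set (ι → ℝ)} (hf : ExpType (tube s) f ψ) {K c : ℝ} (hc : 0 < c)
    (h : ∀ w ∈ tube s, ψ w ≤ K - c * ∑ p, |(w p).re|) : ExpDecay s f := by
  obtain ⟨C, hC, hb⟩ := hf (c / 2) (half_pos hc)
  refine ⟨C * Real.exp K, c / 2, half_pos hc, fun w hw => (hb w hw).trans ?_⟩
  rw [mul_assoc, ← Real.exp_add]
  refine mul_le_mul_of_nonneg_left (Real.exp_le_exp.2 ?_) hC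
  have := h w hw
  linarith

theorem LinGrowth.sub (hf : LinGrowth T f) (hg : LinGrowth T g) :
    LinGrowth T (fun w => f w - g w) := by
  obtain ⟨L, hL, h1⟩ := hf
  obtain ⟨M, hM, h2⟩ := hg
  refine ⟨L + M, by positivity, fun w hw => (norm_sub_le _ _).trans ?_⟩
  rw [add_mul]
  exact add_le_add (h1 w hw) (h2 w hw)

end ExpType

/-! ### The exponent of the integrand -/

theorem sum_sum_sub_sq {m l : ℕ} (x : Fin m → ℝ) (y : Fin l → ℝ) (hx : ∀ j, x j ^ 2 = x j)
    (hy : ∀ j, y j ^ 2 = y j) :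
    ∑ j, ∑ k, (x j - y k) ^ 2 = l * ∑ j, x j + m * ∑ k, y k - 2 * (∑ j, x j) * ∑ k, y k := by
  have h : ∀ j k, (x j - y k) ^ 2 = x j + y k - 2 * x j * y k := by
    intro j k
    linear_combination hx j + hy k
  simp only [h, Finset.sum_sub_distrib, Finset.sum_add_distrib, Finset.sum_const, Finset.card_univ,
    Fintype.card_fin, nsmul_eq_mul, ← Finset.mul_sum, ← Finset.sum_mul]

theorem sum_sum_Ioi_sub_sq {m : ℕ} (x : Fin m → ℝ) (hx : ∀ j, x j ^ 2 = x j) :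
    ∑ j, ∑ k ∈ Finset.Ioi j, (x j - x k) ^ 2 = (∑ j, x j) * (m - ∑ j, x j) := by
  have h1 := Finset.sum_sum_Ioi_add_eq_sum_sum_off_diag (fun j k => (x j - x k) ^ 2)
  have h2 : ∀ i, ∑ j ∈ {i}ᶜ, (x j - x i) ^ 2 = ∑ j, (x j - x i) ^ 2 := by
    intro i
    rw [← Finset.sum_add_sum_compl {i} (fun j => (x j - x i) ^ 2)]
    simp
  have h3 : ∀ i j, (x j - x i) ^ 2 + (x i - x j) ^ 2 = 2 * (x i - x j) ^ 2 := by
    intro i j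
    ring
  simp only [h2, h3, ← Finset.mul_sum] at h1
  have h4 := sum_sum_sub_sq x x hx hx
  rw [Finset.sum_comm] at h4
  rw [h4] at h1
  linarith

/-- With `D n = A (n + 1) - A n`, the quadratic terms are `-D n (D n - 1)` up to a telescoping
sum. -/
theorem sum_range_quadratic_le (A : ℕ → ℝ) (hA : ∀ n, 0 ≤ A n ∧ A n ≤ n) (N : ℕ) :
    ∑ n ∈ Finset.range N, (-(Real.pi / 2) * (((n + 1 : ℕ) : ℝ) * A n + n * A (n + 1)
        - 2 * A n * A (n + 1)) + Real.pi * (A n * (n - A n))) ≤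
      ∑ n ∈ Finset.range N, -(Real.pi / 2) * ((A (n + 1) - A n) * (A (n + 1) - A n - 1)) := by
  have h : ∀ n : ℕ, -(Real.pi / 2) * (((n + 1 : ℕ) : ℝ) * A n + n * A (n + 1)
        - 2 * A n * A (n + 1)) + Real.pi * (A n * (n - A n)) =
      -(Real.pi / 2) * ((A (n + 1) - A n) * (A (n + 1) - A n - 1)) +
      (Real.pi / 2 * (A n * (n - A n)) -
        Real.pi / 2 * (A (n + 1) * ((n + 1 : ℕ) - A (n + 1)))) := by
    intro n
    push_cast
    ring
  simp only [h]
  rw [Finset.sum_add_distrib,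
    Finset.sum_range_sub' (fun n : ℕ => Real.pi / 2 * (A n * (n - A n))) N]
  have h0 : A 0 = 0 := le_antisymm (by simpa using (hA 0).2) (hA 0).1
  have h1 : 0 ≤ Real.pi / 2 * (A N * (N - A N)) :=
    mul_nonneg (by positivity) (mul_nonneg (hA N).1 (sub_nonneg.2 (hA N).2))
  rw [h0]
  linarith

/-- For the indicators `b n j` of `s ≤ t n j` and `b₀` of `s ≤ 0`, the integral of this quantity
over the level `s` is the exponent at the array `t` plus `c` times the sum of the `|t n j|`. -/
def levelExponent (N : ℕ) (θ : Fin N → ℝ) (c : ℝ) (b : (n : ℕ) → Fin n → ℝ) (b₀ : ℝ) : ℝ :=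
  ∑ n ∈ Finset.range N, (-(Real.pi / 2) * ∑ j, ∑ k, (b n j - b (n + 1) k) ^ 2 +
      Real.pi * ∑ j, ∑ k ∈ Finset.Ioi j, (b n j - b n k) ^ 2) +
    ∑ n : Fin N, θ n * (∑ j, (b ((n : ℕ) + 1) j - b₀) - ∑ j, (b (n : ℕ) j - b₀)) +
    c * ∑ n : Fin N, ∑ j, (b (n : ℕ) j - b₀) ^ 2

section Level

variable {N : ℕ} {θ : Fin N → ℝ} {b : (n : ℕ) → Fin n → ℝ} {b₀ : ℝ}

theorem sum_row_mem_Icc (hb : ∀ n j, b n j = 0 ∨ b n j = 1) (n : ℕ) :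
    0 ≤ ∑ j, b n j ∧ ∑ j, b n j ≤ n := by
  refine ⟨Finset.sum_nonneg fun j _ => ?_, ?_⟩
  · rcases hb n j with h | h <;> simp [h]
  · refine (Finset.sum_le_card_nsmul Finset.univ (b n) 1 fun j _ => ?_).trans (by simp)
    rcases hb n j with h | h <;> simp [h]

theorem levelExponent_le_sum_rowDiff (c : ℝ) (hb : ∀ n j, b n j = 0 ∨ b n j = 1) :
    levelExponent N θ c b b₀ ≤
      ∑ n : Fin N, (-(Real.pi / 2) * ((∑ j, b ((n : ℕ) + 1) j - ∑ j, b (n : ℕ) j) *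
          (∑ j, b ((n : ℕ) + 1) j - ∑ j, b (n : ℕ) j - 1)) +
        θ n * (∑ j, b ((n : ℕ) + 1) j - ∑ j, b (n : ℕ) j - b₀)) +
      c * ∑ n : Fin N, ∑ j, (b (n : ℕ) j - b₀) ^ 2 := by
  have hsq : ∀ n j, b n j ^ 2 = b n j := by
    intro n j
    rcases hb n j with h | h <;> simp [h]
  have h1 := sum_range_quadratic_le (fun n => ∑ j, b n j) (sum_row_mem_Icc hb) N
  unfold levelExponent
  rw [Finset.sum_add_distrib (s := (Finset.univ : Finset (Fin N)))]
  refine add_le_add (add_le_add ?_ (le_of_eq ?_)) le_rfl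
  · rw [Fin.sum_univ_eq_sum_range (fun n : ℕ => -(Real.pi / 2) *
      ((∑ j, b (n + 1) j - ∑ j, b n j) * (∑ j, b (n + 1) j - ∑ j, b n j - 1)))]
    refine le_trans (le_of_eq (Finset.sum_congr rfl fun n _ => ?_)) h1
    rw [sum_sum_sub_sq _ _ (hsq n) (hsq (n + 1)), sum_sum_Ioi_sub_sq _ (hsq n)]
  · refine Finset.sum_congr rfl fun n _ => ?_
    simp only [Finset.sum_sub_distrib, Finset.sum_const, Finset.card_univ, Fintype.card_fin,
      nsmul_eq_mul]
    push_cast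
    ring

theorem exists_int_sum_sub (hb : ∀ n j, b n j = 0 ∨ b n j = 1) (n : ℕ) :
    ∃ d : ℤ, ∑ j, b (n + 1) j - ∑ j, b n j = d := by
  have h : ∀ n j, ∃ d : ℤ, b n j = d := by
    intro n j
    rcases hb n j with h | h
    · exact ⟨0, by simp [h]⟩
    · exact ⟨1, by simp [h]⟩
  choose d hd using h
  exact ⟨∑ j, d (n + 1) j - ∑ j, d n j, by simp [hd]⟩

theorem sum_sq_le_card (hb : ∀ n j, b n j = 0 ∨ b n j = 1) (hb₀ : b₀ = 0 ∨ b₀ = 1) :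
    ∑ n : Fin N, ∑ j, (b (n : ℕ) j - b₀) ^ 2 ≤ (N : ℝ) * N := by
  refine (Finset.sum_le_card_nsmul _ _ (N : ℝ) fun n _ => ?_).trans (by simp)
  refine (Finset.sum_le_card_nsmul _ _ (1 : ℝ) fun j _ => ?_).trans ?_
  · rcases hb n j with h | h <;> rcases hb₀ with h' | h' <;> simp [h, h']
  · have : ((n : ℕ) : ℝ) ≤ N := by exact_mod_cast n.isLt.le
    simp [this]

theorem levelExponent_le {c : ℝ} (hc : 0 ≤ c) (hb : ∀ n j, b n j = 0 ∨ b n j = 1)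
    (hb₀ : b₀ = 0 ∨ b₀ = 1) :
    levelExponent N θ c b b₀ ≤ (∑ n, |θ n|) * (N + 1) + c * (N * N) := by
  refine (levelExponent_le_sum_rowDiff c hb).trans (add_le_add ?_
    (mul_le_mul_of_nonneg_left (sum_sq_le_card hb hb₀) hc))
  rw [Finset.sum_mul]
  refine Finset.sum_le_sum fun n _ => ?_
  have h1 := sum_row_mem_Icc hb n
  have h2 := sum_row_mem_Icc hb (n + 1)
  have hn : ((n : ℕ) : ℝ) + 1 ≤ N := by exact_mod_cast n.isLt
  push_cast at h2
  obtain ⟨d, hd⟩ := exists_int_sum_sub hb n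
  have hdd : (0 : ℝ) ≤ (d : ℝ) * (d - 1) := by
    have : 0 ≤ d * (d - 1) := by
      rcases le_or_gt d 0 with h | h <;> nlinarith
    exact_mod_cast this
  have h3 : |(d : ℝ) - b₀| ≤ N + 1 := by
    rw [← hd, abs_le]
    rcases hb₀ with h | h <;> rw [h] <;> constructor <;> linarith
  rw [hd]
  have h4 : θ n * ((d : ℝ) - b₀) ≤ |θ n| * (N + 1) := by
    refine (le_abs_self _).trans ?_
    rw [abs_mul]
    exact mul_le_mul_of_nonneg_left h3 (abs_nonneg _)
  have := Real.pi_pos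
  nlinarith

/-- At the levels `s` where the top row is constant, the exponent is not positive. Here
`E n = D n - b₀` has sum `0`, which turns `∑ θ E` into `∑ (θ - θ₀) E`, and `|E| ≤ E ^ 2`. -/
theorem levelExponent_nonpos {c δ θ₀ : ℝ} (hc : 0 ≤ c) (hcδ : c * N ≤ δ)
    (hθ : ∀ n, |θ n - θ₀| ≤ Real.pi / 2 - δ) (hb : ∀ n j, b n j = 0 ∨ b n j = 1)
    (hb₀ : b₀ = 0 ∨ b₀ = 1) (htop : ∀ j, b N j = b₀) :
    levelExponent N θ c b b₀ ≤ 0 := by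
  refine (levelExponent_le_sum_rowDiff c hb).trans ?_
  set E : ℕ → ℝ := fun n => ∑ j, b (n + 1) j - ∑ j, b n j - b₀ with hE
  have htel : ∀ n : ℕ, ∑ m ∈ Finset.range n, E m = ∑ j, b n j - n * b₀ := by
    intro n
    simp only [hE]
    rw [Finset.sum_sub_distrib, Finset.sum_range_sub (fun n => ∑ j, b n j)]
    simp
  have hE0 : ∑ n : Fin N, E n = 0 := by
    rw [Fin.sum_univ_eq_sum_range, htel]
    simp [htop]
  have hEint : ∀ n, |E n| ≤ E n ^ 2 := by
    intro n
    obtain ⟨d, hd⟩ := exists_int_sum_sub hb n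
    obtain ⟨e, he⟩ : ∃ e : ℤ, E n = e := by
      rcases hb₀ with h | h
      · exact ⟨d, by simp only [hE, hd, h]; simp⟩
      · exact ⟨d - 1, by simp only [hE, hd, h]; simp⟩
    rw [he]
    have : |e| ≤ e ^ 2 := by
      rw [← sq_abs]
      rcases eq_or_lt_of_le (abs_nonneg e) with h | h <;> nlinarith
    exact_mod_cast this
  have hrow : ∀ n : Fin N, ∑ j, (b (n : ℕ) j - b₀) ^ 2 ≤ ∑ m : Fin N, |E m| := by
    intro n
    have h1 : ∑ j, (b (n : ℕ) j - b₀) ^ 2 = |∑ j, b (n : ℕ) j - (n : ℕ) * b₀| := by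
      have h2 : ∑ j, b (n : ℕ) j - (n : ℕ) * b₀ = ∑ j, (b (n : ℕ) j - b₀) := by simp
      rw [h2]
      rcases hb₀ with h | h
      · rw [abs_of_nonneg (Finset.sum_nonneg fun j _ => by
          rcases hb n j with h' | h' <;> simp [h, h'])]
        refine Finset.sum_congr rfl fun j _ => ?_
        rcases hb n j with h' | h' <;> simp [h, h']
      · rw [abs_of_nonpos (Finset.sum_nonpos fun j _ => by
          rcases hb n j with h' | h' <;> simp [h, h']), ← Finset.sum_neg_distrib]
        refine Finset.sum_congr rfl fun j _ => ?_
        rcases hb n j with h' | h' <;> simp [h, h']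
    rw [h1, ← htel, Fin.sum_univ_eq_sum_range (fun m => |E m|)]
    refine (Finset.abs_sum_le_sum_abs _ _).trans ?_
    refine Finset.sum_le_sum_of_subset_of_nonneg ?_ fun _ _ _ => abs_nonneg _
    exact Finset.range_subset_range.2 n.isLt.le
  have hquad : ∑ n : Fin N, (-(Real.pi / 2) * ((∑ j, b ((n : ℕ) + 1) j - ∑ j, b (n : ℕ) j) *
          (∑ j, b ((n : ℕ) + 1) j - ∑ j, b (n : ℕ) j - 1)) +
        θ n * (∑ j, b ((n : ℕ) + 1) j - ∑ j, b (n : ℕ) j - b₀)) =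
      ∑ n : Fin N, (-(Real.pi / 2) * E n ^ 2 + (θ n - θ₀) * E n) +
        (θ₀ - (Real.pi / 2) * (2 * b₀ - 1)) * ∑ n : Fin N, E n := by
    rw [Finset.mul_sum, ← Finset.sum_add_distrib]
    refine Finset.sum_congr rfl fun n _ => ?_
    have h1 : ∑ j, b ((n : ℕ) + 1) j - ∑ j, b (n : ℕ) j = E n + b₀ := by simp [hE]
    rw [h1]
    rcases hb₀ with h | h <;> rw [h] <;> ring
  rw [hquad, hE0, mul_zero, add_zero]
  have h1 : ∑ n : Fin N, (-(Real.pi / 2) * E n ^ 2 + (θ n - θ₀) * E n) ≤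
      ∑ n : Fin N, -δ * |E n| := by
    refine Finset.sum_le_sum fun n _ => ?_
    have h2 : (θ n - θ₀) * E n ≤ (Real.pi / 2 - δ) * |E n| := by
      refine (le_abs_self _).trans ?_
      rw [abs_mul]
      exact mul_le_mul_of_nonneg_right (hθ n) (abs_nonneg _)
    have h3 := mul_le_mul_of_nonneg_left (hEint n) (by positivity : 0 ≤ Real.pi / 2)
    linarith
  have h2 : ∑ n : Fin N, ∑ j, (b (n : ℕ) j - b₀) ^ 2 ≤ N * ∑ m : Fin N, |E m| :=
    (Finset.sum_le_card_nsmul _ _ _ fun n _ => hrow n).trans (by simp)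
  have h3 : 0 ≤ ∑ m : Fin N, |E m| := Finset.sum_nonneg fun _ _ => abs_nonneg _
  have h4 := mul_le_mul_of_nonneg_left h2 hc
  have h5 := mul_le_mul_of_nonneg_right hcδ h3
  rw [← Finset.mul_sum] at h1
  linarith

end Level

/-- The indicator of `s ≤ τ` as a function of `s`. -/
def level (τ s : ℝ) : ℝ := if s ≤ τ then 1 else 0

theorem level_eq (τ s : ℝ) : level τ s = 0 ∨ level τ s = 1 := by
  unfold level
  split_ifs <;> simp

theorem level_of_le {τ s : ℝ} (h : s ≤ τ) : level τ s = 1 := if_pos h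

theorem level_of_lt {τ s : ℝ} (h : τ < s) : level τ s = 0 := if_neg h.not_ge

/-- `f` is integrable over `[-M, M]` with integral `v`. -/
def HasSymmIntegral (M : ℝ) (f : ℝ → ℝ) (v : ℝ) : Prop :=
  IntervalIntegrable f volume (-M) M ∧ ∫ s in (-M)..M, f s = v

section HasSymmIntegral

variable {M : ℝ} {f g : ℝ → ℝ} {v w : ℝ}

theorem HasSymmIntegral.add (hf : HasSymmIntegral M f v) (hg : HasSymmIntegral M g w) :
    HasSymmIntegral M (fun s => f s + g s) (v + w) :=
  ⟨hf.1.add hg.1, by rw [intervalIntegral.integral_add hf.1 hg.1, hf.2, hg.2]⟩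

theorem HasSymmIntegral.sub (hf : HasSymmIntegral M f v) (hg : HasSymmIntegral M g w) :
    HasSymmIntegral M (fun s => f s - g s) (v - w) :=
  ⟨hf.1.sub hg.1, by rw [intervalIntegral.integral_sub hf.1 hg.1, hf.2, hg.2]⟩

theorem HasSymmIntegral.const_mul (c : ℝ) (hf : HasSymmIntegral M f v) :
    HasSymmIntegral M (fun s => c * f s) (c * v) :=
  ⟨hf.1.const_mul c, by rw [intervalIntegral.integral_const_mul, hf.2]⟩

theorem HasSymmIntegral.sum {κ : Type*} (S : Finset κ) {F : κ → ℝ → ℝ} {V : κ → ℝ}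
    (h : ∀ i ∈ S, HasSymmIntegral M (F i) (V i)) :
    HasSymmIntegral M (fun s => ∑ i ∈ S, F i s) (∑ i ∈ S, V i) := by
  classical
  induction S using Finset.induction_on with
  | empty => simp [HasSymmIntegral]
  | insert a S ha ih =>
    simp only [Finset.sum_insert ha]
    exact (h a (Finset.mem_insert_self _ _)).add
      (ih fun i hi => h i (Finset.mem_insert_of_mem hi))

theorem hasSymmIntegral_level {τ : ℝ} (h : |τ| ≤ M) :
    HasSymmIntegral M (level τ) (τ + M) := by
  have h' := abs_le.1 h
  constructor
  · refine Antitone.intervalIntegrable fun s s' hs => ?_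
    unfold level
    split_ifs <;> linarith
  · have h1 : level τ = Set.indicator {s | s ≤ τ} (fun _ => (1 : ℝ)) := by
      ext s
      simp [level, Set.indicator]
    rw [h1, intervalIntegral.integral_indicator (Set.mem_Icc.2 h')]
    simp

theorem hasSymmIntegral_level_sub_sq {τ σ : ℝ} (hτ : |τ| ≤ M) (hσ : |σ| ≤ M) :
    HasSymmIntegral M (fun s => (level τ s - level σ s) ^ 2) |τ - σ| := by
  wlog h : σ ≤ τ generalizing τ σ
  · have := this hσ hτ (le_of_not_ge h)
    rw [abs_sub_comm]
    convert this using 2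
    ring
  · have h1 := (hasSymmIntegral_level hτ).sub (hasSymmIntegral_level hσ)
    have h2 : (fun s => (level τ s - level σ s) ^ 2) = fun s => level τ s - level σ s := by
      funext s
      unfold level
      split_ifs with h3 h4 h4
      · simp
      · simp
      · exact absurd (h4.trans h) h3
      · simp
    rw [h2, abs_of_nonneg (sub_nonneg.2 h)]
    convert h1 using 1
    ring

theorem hasSymmIntegral_level_sub_zero {τ : ℝ} (hτ : |τ| ≤ M) :
    HasSymmIntegral M (fun s => level τ s - level 0 s) τ := by
  have h0 : |(0 : ℝ)| ≤ M := by
    rw [abs_zero]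
    exact (abs_nonneg τ).trans hτ
  have h1 := (hasSymmIntegral_level hτ).sub (hasSymmIntegral_level h0)
  convert h1 using 1
  ring

end HasSymmIntegral

/-- The exponent of the integrand goes to `-∞` at least linearly if the `θ n` differ by less than
`π`. Writing each absolute value as an integral over levels, this follows from the corresponding
inequality for the number of entries of each row above a level. -/
theorem exists_exponent_le {N : ℕ} (θ : Fin N → ℝ) (hθ : ∀ i j, |θ i - θ j| < Real.pi) (R : ℝ) :
    ∃ K c : ℝ, 0 < c ∧ ∀ t : (n : ℕ) → Fin n → ℝ, (∀ j, |t N j| ≤ R) →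
      ∑ n ∈ Finset.range N, (-(Real.pi / 2) * ∑ j, ∑ k, |t n j - t (n + 1) k| +
          Real.pi * ∑ j, ∑ k ∈ Finset.Ioi j, |t n j - t n k|) +
        ∑ n : Fin N, θ n * (∑ j, t ((n : ℕ) + 1) j - ∑ j, t (n : ℕ) j) ≤
      K - c * ∑ n : Fin N, ∑ j, |t (n : ℕ) j| := by
  -- `θ₀` is the midpoint of the range of `θ`
  obtain ⟨θ₀, δ, hδ, hθ₀⟩ : ∃ θ₀ δ : ℝ, 0 < δ ∧ ∀ n, |θ n - θ₀| ≤ Real.pi / 2 - δ := by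
    rcases isEmpty_or_nonempty (Fin N) with h | h
    · exact ⟨0, 1, one_pos, fun n => h.elim n⟩
    · obtain ⟨i, hi⟩ := Finite.exists_max θ
      obtain ⟨j, hj⟩ := Finite.exists_min θ
      refine ⟨(θ i + θ j) / 2, (Real.pi - (θ i - θ j)) / 2, ?_, fun n => ?_⟩
      · have := (abs_lt.1 (hθ i j)).2
        linarith
      · have h1 := hi n
        have h2 := hj n
        rw [abs_le]
        constructor <;> linarith
  set c : ℝ := δ / (N + 1) with hc
  have hc0 : 0 < c := by positivity
  have hcδ : c * N ≤ δ := by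
    rw [hc, div_mul_eq_mul_div, div_le_iff₀ (by positivity)]
    nlinarith
  set R' := max R 0 with hR'
  set K₀ := (∑ n, |θ n|) * (N + 1) + c * (N * N) with hK₀
  have hK₀0 : 0 ≤ K₀ := by
    have : 0 ≤ ∑ n, |θ n| := Finset.sum_nonneg fun _ _ => abs_nonneg _
    positivity
  refine ⟨K₀ * (2 * R'), c, hc0, fun t ht => ?_⟩
  have hR0 : 0 ≤ R' := le_max_right _ _
  -- all entries lie in `[-M, M]`, and the levels outside `[-R', R']` contribute at most `0`
  set M := R' + ∑ n ∈ Finset.range (N + 1), ∑ j, |t n j| with hM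
  have hsum : ∀ n ∈ Finset.range (N + 1), 0 ≤ ∑ j, |t n j| := fun n _ =>
    Finset.sum_nonneg fun _ _ => abs_nonneg _
  have hRM : R' ≤ M := le_add_of_nonneg_right (Finset.sum_nonneg hsum)
  have htM : ∀ n ≤ N, ∀ j, |t n j| ≤ M := by
    intro n hn j
    have h1 := Finset.single_le_sum hsum (Finset.mem_range.2 (Nat.lt_succ_of_le hn))
    have h2 := Finset.single_le_sum (f := fun j => |t n j|) (fun _ _ => abs_nonneg _)
      (Finset.mem_univ j)
    linarith
  have hmain : HasSymmIntegral M
      (fun s => levelExponent N θ c (fun n j => level (t n j) s) (level 0 s))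
      (∑ n ∈ Finset.range N, (-(Real.pi / 2) * ∑ j, ∑ k, |t n j - t (n + 1) k| +
          Real.pi * ∑ j, ∑ k ∈ Finset.Ioi j, |t n j - t n k|) +
        ∑ n : Fin N, θ n * (∑ j, t ((n : ℕ) + 1) j - ∑ j, t (n : ℕ) j) +
        c * ∑ n : Fin N, ∑ j, |t (n : ℕ) j|) := by
    unfold levelExponent
    refine ((HasSymmIntegral.sum _ fun n hn => ?_).add (HasSymmIntegral.sum _ fun n _ => ?_)).add
      (HasSymmIntegral.const_mul _ (HasSymmIntegral.sum _ fun n _ =>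
        HasSymmIntegral.sum _ fun j _ => ?_))
    · have hn := Finset.mem_range.1 hn
      refine (HasSymmIntegral.const_mul _ (HasSymmIntegral.sum _ fun j _ =>
        HasSymmIntegral.sum _ fun k _ => ?_)).add (HasSymmIntegral.const_mul _
        (HasSymmIntegral.sum _ fun j _ => HasSymmIntegral.sum _ fun k _ => ?_))
      · exact hasSymmIntegral_level_sub_sq (htM n hn.le j) (htM (n + 1) hn k)
      · exact hasSymmIntegral_level_sub_sq (htM n hn.le j) (htM n hn.le k)
    · refine HasSymmIntegral.const_mul _ ((HasSymmIntegral.sum _ fun j _ => ?_).sub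
        (HasSymmIntegral.sum _ fun j _ => ?_))
      · exact hasSymmIntegral_level_sub_zero (htM _ n.isLt j)
      · exact hasSymmIntegral_level_sub_zero (htM _ n.isLt.le j)
    · have h1 := hasSymmIntegral_level_sub_sq (htM _ n.isLt.le j) (σ := 0)
        (by rw [abs_zero]; exact hR0.trans hRM)
      simpa using h1
  have hcmp : HasSymmIntegral M (fun s => K₀ * (level R' s - level (-R') s)) (K₀ * (2 * R')) := by
    have h1 := ((hasSymmIntegral_level (M := M) (τ := R') (by rwa [abs_of_nonneg hR0])).sub
      (hasSymmIntegral_level (M := M) (τ := -R')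
        (by rwa [abs_neg, abs_of_nonneg hR0]))).const_mul K₀
    convert h1 using 2
    ring
  have hle := intervalIntegral.integral_mono_on (by linarith : -M ≤ M) hmain.1 hcmp.1
    (fun s _ => ?_)
  · rw [hmain.2, hcmp.2] at hle
    linarith
  · have hb : ∀ n j, level (t n j) s = 0 ∨ level (t n j) s = 1 := fun n j => level_eq _ _
    have hgen := levelExponent_le (N := N) (θ := θ) hc0.le hb (level_eq 0 s)
    have hnonpos := levelExponent_nonpos (N := N) (θ := θ) hc0.le hcδ hθ₀ hb (level_eq 0 s)
    have htR : ∀ j, |t N j| ≤ R' := fun j => (ht j).trans (le_max_left _ _)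
    rcases le_or_gt s (-R') with h1 | h1
    · rw [level_of_le h1, level_of_le (by linarith : s ≤ R'), sub_self, mul_zero]
      refine hnonpos fun j => ?_
      rw [level_of_le (h1.trans (abs_le.1 (htR j)).1), level_of_le (by linarith)]
    · rw [level_of_lt h1]
      rcases le_or_gt s R' with h2 | h2
      · rw [level_of_le h2, sub_zero, mul_one]
        exact hgen
      · rw [level_of_lt h2, sub_zero, mul_zero]
        refine hnonpos fun j => ?_
        rw [level_of_lt ((abs_le.1 (htR j)).2.trans_lt h2), level_of_lt (by linarith)]

/-! ### A duality of symmetric rational functions -/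

theorem prod_sub_comm {K : Type*} [Field K] (I : Finset K) (u : K) :
    ∏ i ∈ I, (u - i) = (-1) ^ I.card * ∏ i ∈ I, (i - u) := by
  rw [← Finset.prod_const, ← Finset.prod_mul_distrib]
  exact Finset.prod_congr rfl fun i _ => by ring

theorem natDegree_prod_X_sub_C_le {K : Type*} [Field K] (s : Finset K) :
    (∏ j ∈ s, (Polynomial.X - Polynomial.C j)).natDegree ≤ s.card := by
  rw [Polynomial.natDegree_finsetProd_X_sub_C_eq_card]

section Duality

variable {K : Type*} [Field K] [DecidableEq K]

/-- `∏_{i ∈ I} ∏_{j ∈ X ∖ I} 1 / (i - j)` for a subset `I` of a finite set `X` of a field. -/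
def splitWeight (X I : Finset K) : K := ∏ i ∈ I, ∏ j ∈ X \ I, (i - j)⁻¹

theorem splitWeight_insert_of_notMem {X I : Finset K} {u : K} (hu : u ∉ X) (hI : I ⊆ X) :
    splitWeight (insert u X) I = splitWeight X I * ∏ i ∈ I, (i - u)⁻¹ := by
  unfold splitWeight
  rw [← Finset.prod_mul_distrib]
  refine Finset.prod_congr rfl fun i _ => ?_
  rw [Finset.insert_sdiff_of_notMem _ (fun h => hu (hI h)),
    Finset.prod_insert (fun h => hu (Finset.mem_sdiff.1 h).1), mul_comm]

theorem splitWeight_insert_insert {X I : Finset K} {u : K} (hu : u ∉ X) (hI : I ⊆ X) :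
    splitWeight (insert u X) (insert u I) = splitWeight X I * ∏ j ∈ X \ I, (u - j)⁻¹ := by
  unfold splitWeight
  have h : insert u X \ insert u I = X \ I := by
    ext j
    simp only [Finset.mem_sdiff, Finset.mem_insert]
    constructor
    · rintro ⟨rfl | h1, h2⟩
      · exact absurd (Or.inl rfl) h2
      · exact ⟨h1, fun h3 => h2 (Or.inr h3)⟩
    · rintro ⟨h1, h2⟩
      refine ⟨Or.inr h1, ?_⟩
      rintro (rfl | h3)
      · exact hu h1
      · exact h2 h3
  rw [h, Finset.prod_insert (fun h => hu (hI h)), mul_comm]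

theorem sum_powersetCard_succ_insert {α M : Type*} [DecidableEq α] [AddCommMonoid M] {a : α}
    {s : Finset α} (ha : a ∉ s) (k : ℕ) (f : Finset α → M) :
    ∑ I ∈ (insert a s).powersetCard (k + 1), f I =
      ∑ I ∈ s.powersetCard (k + 1), f I + ∑ I ∈ s.powersetCard k, f (insert a I) := by
  have hmem : ∀ n, ∀ I ∈ s.powersetCard n, a ∉ I := fun n I hI h =>
    ha ((Finset.mem_powersetCard.1 hI).1 h)
  rw [Finset.powersetCard_succ_insert ha, Finset.sum_union, Finset.sum_image]
  · intro I hI J hJ h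
    have := congrArg (fun s => Finset.erase s a) h
    simpa [Finset.erase_insert (hmem k I hI), Finset.erase_insert (hmem k J hJ)] using this
  · rw [Finset.disjoint_left]
    rintro I hI hI'
    obtain ⟨J, _, rfl⟩ := Finset.mem_image.1 hI'
    exact hmem _ _ hI (Finset.mem_insert_self _ _)

theorem sum_powersetCard_insert_of_eq_zero {α M : Type*} [DecidableEq α] [AddCommMonoid M] {a : α}
    {s : Finset α} (k : ℕ) (f : Finset α → M) (hf : ∀ I, a ∈ I → f I = 0) :
    ∑ I ∈ (insert a s).powersetCard k, f I = ∑ I ∈ s.powersetCard k, f I := by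
  refine (Finset.sum_subset (Finset.powersetCard_mono (Finset.subset_insert _ _)) ?_).symm
  intro I hI hI'
  apply hf
  by_contra ha
  rw [Finset.mem_powersetCard] at hI hI'
  exact hI' ⟨(Finset.subset_insert_iff_of_notMem ha).1 hI.1, hI.2⟩

/-- `∑_{I ⊆ X, |I| = k + 1} ∏_{i ∈ I, j ∈ X ∖ I} 1 / (i - j) ∏_{i ∈ I, y ∈ Y} (i - y)`. -/
def upperSum (X Y : Finset K) (k : ℕ) : K :=
  ∑ I ∈ X.powersetCard (k + 1), splitWeight X I * ∏ i ∈ I, ∏ y ∈ Y, (i - y)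

/-- `∑_{J ⊆ Y, |J| = k} ∏_{j ∈ J, l ∈ Y ∖ J} 1 / (j - l) ∏_{j ∈ J, x ∈ X} (j - x)`. -/
def lowerSum (X Y : Finset K) (k : ℕ) : K :=
  ∑ J ∈ Y.powersetCard k, splitWeight Y J * ∏ j ∈ J, ∏ x ∈ X, (j - x)

/-- `upperSum (insert u X) Y k` times `∏ x ∈ X, (u - x)`, as a polynomial in `u`. -/
def upperPoly (X Y : Finset K) (k : ℕ) : Polynomial K :=
  ∑ I ∈ X.powersetCard (k + 1), Polynomial.C (splitWeight X I * (∏ i ∈ I, ∏ y ∈ Y, (i - y)) *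
      (-1) ^ (k + 1)) * ∏ j ∈ X \ I, (Polynomial.X - Polynomial.C j) +
    ∑ I ∈ X.powersetCard k, Polynomial.C (splitWeight X I * ∏ i ∈ I, ∏ y ∈ Y, (i - y)) *
      ((∏ y ∈ Y, (Polynomial.X - Polynomial.C y)) * ∏ j ∈ I, (Polynomial.X - Polynomial.C j))

/-- `lowerSum (insert u X) Y k` times `∏ x ∈ X, (u - x)`, as a polynomial in `u`. -/
def lowerPoly (X Y : Finset K) (k : ℕ) : Polynomial K :=
  ∑ J ∈ Y.powersetCard k, Polynomial.C (splitWeight Y J * (∏ j ∈ J, ∏ x ∈ X, (j - x)) *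
      (-1) ^ k) * ((∏ x ∈ X, (Polynomial.X - Polynomial.C x)) *
        ∏ j ∈ J, (Polynomial.X - Polynomial.C j))

theorem eval_upperPoly (X Y : Finset K) (k : ℕ) (u : K) :
    (upperPoly X Y k).eval u =
      ∑ I ∈ X.powersetCard (k + 1), splitWeight X I * (∏ i ∈ I, ∏ y ∈ Y, (i - y)) *
        (-1) ^ (k + 1) * ∏ j ∈ X \ I, (u - j) +
      ∑ I ∈ X.powersetCard k, splitWeight X I * (∏ i ∈ I, ∏ y ∈ Y, (i - y)) *
        ((∏ y ∈ Y, (u - y)) * ∏ j ∈ I, (u - j)) := by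
  simp [upperPoly, Polynomial.eval_finsetSum, Polynomial.eval_prod]

theorem eval_lowerPoly (X Y : Finset K) (k : ℕ) (u : K) :
    (lowerPoly X Y k).eval u =
      ∑ J ∈ Y.powersetCard k, splitWeight Y J * (∏ j ∈ J, ∏ x ∈ X, (j - x)) * (-1) ^ k *
        ((∏ x ∈ X, (u - x)) * ∏ j ∈ J, (u - j)) := by
  simp [lowerPoly, Polynomial.eval_finsetSum, Polynomial.eval_prod]

theorem eval_upperPoly_of_notMem {X Y : Finset K} {k : ℕ} {u : K} (hu : u ∉ X) :
    (upperPoly X Y k).eval u = upperSum (insert u X) Y k * ∏ x ∈ X, (u - x) := by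
  have hne : ∀ j ∈ X, u - j ≠ 0 := fun j hj => sub_ne_zero.2 fun h => hu (h ▸ hj)
  rw [eval_upperPoly, upperSum, sum_powersetCard_succ_insert hu, add_mul, Finset.sum_mul,
    Finset.sum_mul]
  congr 1
  · refine Finset.sum_congr rfl fun I hI => ?_
    obtain ⟨hI, hc⟩ := Finset.mem_powersetCard.1 hI
    rw [splitWeight_insert_of_notMem hu hI, ← Finset.prod_sdiff hI, prod_sub_comm I, hc,
      Finset.prod_inv_distrib]
    have : ∏ i ∈ I, (i - u) ≠ 0 :=
      Finset.prod_ne_zero_iff.2 fun i hi => sub_ne_zero.2 fun h => hu (h ▸ hI hi)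
    field_simp
  · refine Finset.sum_congr rfl fun I hI => ?_
    obtain ⟨hI, hc⟩ := Finset.mem_powersetCard.1 hI
    rw [splitWeight_insert_insert hu hI, ← Finset.prod_sdiff hI,
      Finset.prod_insert (fun h => hu (hI h)), Finset.prod_inv_distrib]
    have : ∏ j ∈ X \ I, (u - j) ≠ 0 :=
      Finset.prod_ne_zero_iff.2 fun i hi => hne i (Finset.mem_sdiff.1 hi).1
    field_simp

theorem eval_lowerPoly_of_notMem {X Y : Finset K} {k : ℕ} {u : K} (hu : u ∉ X) :
    (lowerPoly X Y k).eval u = lowerSum (insert u X) Y k * ∏ x ∈ X, (u - x) := by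
  rw [eval_lowerPoly, lowerSum, Finset.sum_mul]
  refine Finset.sum_congr rfl fun J hJ => ?_
  obtain ⟨-, hc⟩ := Finset.mem_powersetCard.1 hJ
  simp only [Finset.prod_insert hu, Finset.prod_mul_distrib]
  rw [prod_sub_comm J, hc]
  have : ((-1 : K) ^ k) * (-1) ^ k = 1 := by rw [← mul_pow]; simp
  linear_combination (splitWeight Y J * (∏ j ∈ J, ∏ x ∈ X, (j - x)) * (∏ x ∈ X, (u - x)) *
    ∏ i ∈ J, (i - u)) * this

/-- The residues of `upperSum` at coinciding points of `X` cancel in pairs. -/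
theorem eval_upperPoly_of_mem {X Y : Finset K} {k : ℕ} {a : K} (ha : a ∈ X) :
    (upperPoly X Y k).eval a = 0 := by
  obtain ⟨X, haX, rfl⟩ : ∃ X', a ∉ X' ∧ insert a X' = X :=
    ⟨X.erase a, Finset.notMem_erase _ _, Finset.insert_erase ha⟩
  rw [eval_upperPoly, sum_powersetCard_succ_insert haX,
    sum_powersetCard_insert_of_eq_zero _ _ (fun I hI => by
      rw [Finset.prod_eq_zero hI (sub_self a), mul_zero, mul_zero]),
    Finset.sum_eq_zero, zero_add, ← Finset.sum_add_distrib, Finset.sum_eq_zero]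
  · intro I hI
    obtain ⟨hI, hc⟩ := Finset.mem_powersetCard.1 hI
    have h1 : insert a X \ insert a I = X \ I := by
      rw [Finset.insert_sdiff_insert, Finset.sdiff_insert_of_notMem haX]
    have haI : a ∉ I := fun h => haX (hI h)
    have h2 : ∏ j ∈ X \ I, (a - j) ≠ 0 := Finset.prod_ne_zero_iff.2 fun j hj =>
      sub_ne_zero.2 fun h => haX (h ▸ (Finset.mem_sdiff.1 hj).1)
    have h3 : ∏ i ∈ I, (i - a) ≠ 0 := Finset.prod_ne_zero_iff.2 fun j hj =>
      sub_ne_zero.2 fun h => haI (h ▸ hj)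
    rw [h1, splitWeight_insert_insert haX hI, splitWeight_insert_of_notMem haX hI,
      Finset.prod_insert haI, prod_sub_comm I, hc, Finset.prod_inv_distrib,
      Finset.prod_inv_distrib]
    field_simp
    ring
  · intro I hI
    obtain ⟨hI, hc⟩ := Finset.mem_powersetCard.1 hI
    have : a ∈ insert a X \ I :=
      Finset.mem_sdiff.2 ⟨Finset.mem_insert_self _ _, fun h => haX (hI h)⟩
    rw [Finset.prod_eq_zero this (sub_self a), mul_zero]

theorem eval_lowerPoly_of_mem {X Y : Finset K} {k : ℕ} {a : K} (ha : a ∈ X) :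
    (lowerPoly X Y k).eval a = 0 := by
  rw [eval_lowerPoly]
  refine Finset.sum_eq_zero fun J _ => ?_
  rw [Finset.prod_eq_zero ha (sub_self a)]
  ring

theorem upperSum_insert_insert {X Y : Finset K} {k : ℕ} {y : K} (hX : y ∉ X) (hY : y ∉ Y) :
    upperSum (insert y X) (insert y Y) k = upperSum X Y k := by
  unfold upperSum
  rw [sum_powersetCard_insert_of_eq_zero]
  · refine Finset.sum_congr rfl fun I hI => ?_
    obtain ⟨hI, -⟩ := Finset.mem_powersetCard.1 hI
    have h3 : ∏ i ∈ I, (i - y) ≠ 0 := Finset.prod_ne_zero_iff.2 fun j hj =>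
      sub_ne_zero.2 fun h => hX (h ▸ hI hj)
    simp only [Finset.prod_insert hY, Finset.prod_mul_distrib]
    rw [splitWeight_insert_of_notMem hX hI, Finset.prod_inv_distrib]
    field_simp
  · intro I hI
    rw [Finset.prod_eq_zero hI (Finset.prod_eq_zero (Finset.mem_insert_self y Y) (sub_self y)),
      mul_zero]

theorem lowerSum_insert_insert {X Y : Finset K} {k : ℕ} {y : K} (hX : y ∉ X) (hY : y ∉ Y) :
    lowerSum (insert y X) (insert y Y) k = lowerSum X Y k := by
  unfold lowerSum
  rw [sum_powersetCard_insert_of_eq_zero]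
  · refine Finset.sum_congr rfl fun I hI => ?_
    obtain ⟨hI, -⟩ := Finset.mem_powersetCard.1 hI
    have h3 : ∏ i ∈ I, (i - y) ≠ 0 := Finset.prod_ne_zero_iff.2 fun j hj =>
      sub_ne_zero.2 fun h => hY (h ▸ hI hj)
    simp only [Finset.prod_insert hX, Finset.prod_mul_distrib]
    rw [splitWeight_insert_of_notMem hY hI, Finset.prod_inv_distrib]
    field_simp
  · intro I hI
    rw [Finset.prod_eq_zero hI (Finset.prod_eq_zero (Finset.mem_insert_self y X) (sub_self y)),
      mul_zero]

theorem natDegree_upperPoly_le (X Y : Finset K) (k : ℕ) (h : X.card = Y.card) :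
    (upperPoly X Y k).natDegree ≤ Y.card + k := by
  unfold upperPoly
  refine Polynomial.natDegree_add_le_of_degree_le ?_ ?_
  · refine Polynomial.natDegree_sum_le_of_forall_le _ _ fun I hI => ?_
    refine (Polynomial.natDegree_C_mul_le _ _).trans ((natDegree_prod_X_sub_C_le _).trans ?_)
    have := Finset.card_le_card (Finset.sdiff_subset (s := X) (t := I))
    omega
  · refine Polynomial.natDegree_sum_le_of_forall_le _ _ fun I hI => ?_
    obtain ⟨-, hc⟩ := Finset.mem_powersetCard.1 hI
    refine (Polynomial.natDegree_C_mul_le _ _).trans (Polynomial.natDegree_mul_le.trans ?_)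
    have h1 := natDegree_prod_X_sub_C_le Y
    have h2 := natDegree_prod_X_sub_C_le I
    omega

theorem natDegree_lowerPoly_le (X Y : Finset K) (k : ℕ) (h : X.card = Y.card) :
    (lowerPoly X Y k).natDegree ≤ Y.card + k := by
  unfold lowerPoly
  refine Polynomial.natDegree_sum_le_of_forall_le _ _ fun I hI => ?_
  obtain ⟨-, hc⟩ := Finset.mem_powersetCard.1 hI
  refine (Polynomial.natDegree_C_mul_le _ _).trans (Polynomial.natDegree_mul_le.trans ?_)
  have h1 := natDegree_prod_X_sub_C_le X
  have h2 := natDegree_prod_X_sub_C_le I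
  omega

/-- The duality between the sums over subsets of `X` and of `Y`. As functions of one element `u`
of `X`, both sides become polynomials of degree less than `2 |Y|` after multiplication with
`∏ x, (u - x)`; these agree at the other elements of `X`, where both vanish, and at the elements
of `Y`, by induction. -/
theorem upperSum_eq_lowerSum {X Y : Finset K} {k : ℕ} (hXY : Disjoint X Y)
    (hcard : X.card = Y.card + 1) (hk : k ≤ Y.card) : upperSum X Y k = lowerSum X Y k := by
  induction hn : Y.card generalizing X Y with
  | zero =>
    have hk0 : k = 0 := by omega
    subst hk0
    obtain ⟨x, rfl⟩ := Finset.card_eq_one.1 (by omega : X.card = 1)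
    obtain rfl := Finset.card_eq_zero.1 hn
    simp [upperSum, lowerSum, splitWeight, Finset.powersetCard_one]
  | succ n ih =>
    rcases hk.eq_or_lt with rfl | hk
    · -- the count of zeros falls short for `k = |Y|`, where both sums have a single term
      unfold upperSum lowerSum
      rw [← hcard, Finset.powersetCard_self, Finset.powersetCard_self]
      simp only [splitWeight, Finset.sum_singleton, Finset.sdiff_self, Finset.prod_empty,
        Finset.prod_const_one, one_mul]
      rw [Finset.prod_comm]
      have h1 : ∀ y ∈ Y, ∏ x ∈ X, (x - y) = (-1) ^ X.card * ∏ x ∈ X, (y - x) := by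
        intro y _
        rw [prod_sub_comm X y, ← mul_assoc, ← mul_pow]
        simp
      rw [Finset.prod_congr rfl h1, Finset.prod_mul_distrib, Finset.prod_const, ← pow_mul, hcard,
        mul_comm (Y.card + 1), (Nat.even_mul_succ_self _).neg_one_pow, one_mul]
    · obtain ⟨x, hx⟩ := Finset.card_pos.1 (by omega : 0 < X.card)
      obtain ⟨X, hxX, rfl⟩ : ∃ X', x ∉ X' ∧ insert x X' = X :=
        ⟨X.erase x, Finset.notMem_erase _ _, Finset.insert_erase hx⟩
      rw [Finset.card_insert_of_notMem hxX, add_left_inj] at hcard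
      have hXY' : Disjoint X Y := hXY.mono_left (Finset.subset_insert _ _)
      have hpoly : upperPoly X Y k = lowerPoly X Y k := by
        refine Polynomial.eq_of_degree_sub_lt_of_eval_finset_eq (X ∪ Y) ?_ ?_
        · refine lt_of_le_of_lt (Polynomial.degree_le_natDegree) ?_
          rw [Finset.card_union_of_disjoint hXY', hcard]
          have h1 := natDegree_upperPoly_le X Y k hcard
          have h2 := natDegree_lowerPoly_le X Y k hcard
          have h3 := Polynomial.natDegree_sub_le (upperPoly X Y k) (lowerPoly X Y k)
          have h4 : (upperPoly X Y k - lowerPoly X Y k).natDegree < Y.card + Y.card := by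
            have := max_le h1 h2
            omega
          exact_mod_cast h4
        · intro u hu
          by_cases huX : u ∈ X
          · rw [eval_upperPoly_of_mem huX, eval_lowerPoly_of_mem huX]
          · have huY : u ∈ Y := (Finset.mem_union.1 hu).resolve_left huX
            rw [eval_upperPoly_of_notMem huX, eval_lowerPoly_of_notMem huX]
            congr 1
            obtain ⟨Y, huY', rfl⟩ : ∃ Y', u ∉ Y' ∧ insert u Y' = Y :=
              ⟨Y.erase u, Finset.notMem_erase _ _, Finset.insert_erase huY⟩
            rw [Finset.card_insert_of_notMem huY'] at hcard hn hk
            rw [upperSum_insert_insert huX huY', lowerSum_insert_insert huX huY']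
            exact ih (hXY'.mono_right (Finset.subset_insert _ _)) hcard (by omega) (by omega)
      have h1 := congrArg (Polynomial.eval x) hpoly
      rw [eval_upperPoly_of_notMem hxX, eval_lowerPoly_of_notMem hxX] at h1
      have h2 : ∏ j ∈ X, (x - j) ≠ 0 := Finset.prod_ne_zero_iff.2 fun j hj =>
        sub_ne_zero.2 fun h => hxX (h ▸ hj)
      exact mul_right_cancel₀ h2 h1

end Duality

/-! ### The integrand in the variables `γ / (iħ)` and its behaviour under shifts -/

/-- The entire function `1 / (Γ(u) Γ(-u))`. -/
def invGammaPair (u : ℂ) : ℂ := -(u * Complex.sin (Real.pi * u) / Real.pi)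

/-- This holds at the poles of the Gamma functions too, where Mathlib's `Γ` is `0`. -/
theorem inv_Gamma_mul_Gamma_neg (u : ℂ) :
    (Complex.Gamma u * Complex.Gamma (-u))⁻¹ = invGammaPair u := by
  unfold invGammaPair
  rcases eq_or_ne u 0 with rfl | hu
  · simp
  · have h1 := Complex.Gamma_mul_Gamma_one_sub u
    have h2 : (1 : ℂ) - u = -u + 1 := by ring
    rw [h2, Complex.Gamma_add_one (-u) (neg_ne_zero.2 hu)] at h1
    have h3 : Complex.Gamma u * Complex.Gamma (-u) =
        (Real.pi / Complex.sin (Real.pi * u)) / (-u) := by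
      rw [← h1]
      field_simp
    rw [h3, inv_div, div_div_eq_mul_div]
    ring

/-- Subtract `1` from the entries with index in `J`. -/
def shiftBy {n : ℕ} (J : Finset (Fin n)) (y : Fin n → ℂ) (j : Fin n) : ℂ :=
  if j ∈ J then y j - 1 else y j

/-- The Gamma functions that couple the rows `y` and `x`. -/
def gammaFactor {n : ℕ} (y : Fin n → ℂ) (x : Fin (n + 1) → ℂ) : ℂ :=
  ∏ j, ∏ k, Complex.Gamma (y j - x k)

/-- The inverse Gamma functions that belong to the single row `y`. -/
def pairFactor {n : ℕ} (y : Fin n → ℂ) : ℂ :=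
  ∏ j, ∏ k ∈ Finset.Ioi j, invGammaPair (y j - y k)

/-- The logarithm of the exponential factor, up to sign. -/
def linForm (N : ℕ) (Q : ℕ → ℂ) (z : (n : ℕ) → Fin n → ℂ) : ℂ :=
  ∑ n ∈ Finset.range N, Q n * (∑ j, z (n + 1) j - ∑ j, z n j)

/-- The integrand as a function of the array `z = γ / (iħ)`, with the powers of `c` absorbed into
the parameters `Q`. -/
def core (N : ℕ) (Q : ℕ → ℂ) (z : (n : ℕ) → Fin n → ℂ) : ℂ :=
  Complex.exp (-linForm N Q z) *
    ∏ n ∈ Finset.range N, gammaFactor (z n) (z (n + 1)) * pairFactor (z n)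

theorem gammaFactor_shiftBy_right {n : ℕ} (I : Finset (Fin (n + 1))) (y : Fin n → ℂ)
    (x : Fin (n + 1) → ℂ) (h : ∀ j k, y j ≠ x k) :
    gammaFactor y (shiftBy I x) = gammaFactor y x * ∏ i ∈ I, ∏ j, (y j - x i) := by
  unfold gammaFactor
  rw [Finset.prod_comm, Finset.prod_comm (f := fun j k => Complex.Gamma (y j - x k)),
    ← Finset.univ_inter I, ← Finset.prod_ite_mem, ← Finset.prod_mul_distrib, Finset.univ_inter]
  refine Finset.prod_congr rfl fun i _ => ?_
  unfold shiftBy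
  split_ifs with hi
  · rw [← Finset.prod_mul_distrib]
    refine Finset.prod_congr rfl fun j _ => ?_
    rw [sub_sub_eq_add_sub, add_sub_right_comm, Complex.Gamma_add_one _ (sub_ne_zero.2 (h j i)),
      mul_comm]
  · rw [mul_one]

theorem gammaFactor_shiftBy_left {n : ℕ} (J : Finset (Fin n)) (y : Fin n → ℂ)
    (x : Fin (n + 1) → ℂ) (h : ∀ j k, y j - 1 ≠ x k) :
    gammaFactor (shiftBy J y) x * ∏ j ∈ J, ∏ i, (y j - 1 - x i) = gammaFactor y x := by
  unfold gammaFactor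
  rw [← Finset.univ_inter J, ← Finset.prod_ite_mem, ← Finset.prod_mul_distrib, Finset.univ_inter]
  refine Finset.prod_congr rfl fun j _ => ?_
  unfold shiftBy
  split_ifs with hj
  · rw [← Finset.prod_mul_distrib]
    refine Finset.prod_congr rfl fun k _ => ?_
    have h1 : y j - x k = (y j - 1 - x k) + 1 := by ring
    rw [h1, Complex.Gamma_add_one _ (sub_ne_zero.2 (h j k)), mul_comm]
  · rw [mul_one]

theorem prod_prod_compl_eq_prod_Ioi {n : ℕ} (J : Finset (Fin n)) (f : Fin n → Fin n → ℂ) :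
    ∏ j ∈ J, ∏ l ∈ Jᶜ, f j l = ∏ i, ∏ j ∈ Finset.Ioi i,
      (if j ∈ J ∧ i ∉ J then f j i else 1) * (if i ∈ J ∧ j ∉ J then f i j else 1) := by
  rw [Finset.prod_prod_Ioi_mul_eq_prod_prod_off_diag
    (fun j i => if j ∈ J ∧ i ∉ J then f j i else 1)]
  have h1 : ∀ i, ∏ j ∈ {i}ᶜ, (if j ∈ J ∧ i ∉ J then f j i else 1) =
      ∏ j, (if j ∈ J ∧ i ∉ J then f j i else 1) := by
    intro i
    rw [← Finset.prod_mul_prod_compl {i} (fun j => if j ∈ J ∧ i ∉ J then f j i else 1)]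
    simp
  have h2 : ∀ j, ∏ l, (if j ∈ J ∧ l ∉ J then f j l else 1) =
      if j ∈ J then ∏ l ∈ Jᶜ, f j l else 1 := by
    intro j
    split_ifs with hj
    · rw [← Finset.univ_inter Jᶜ, ← Finset.prod_ite_mem]
      simp [hj]
    · simp [hj]
  simp only [h1]
  symm
  rw [Finset.prod_comm]
  simp only [h2]
  rw [Finset.prod_ite_mem, Finset.univ_inter]

/-- The sine in `invGammaPair` changes its sign under a unit shift; the poles of `S J` are
cancelled by the other factor of `invGammaPair`. -/
theorem pairFactor_shiftBy {n : ℕ} (J : Finset (Fin n)) (y : Fin n → ℂ)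
    (hy : Function.Injective y) (h : ∀ j l, y j - 1 ≠ y l) :
    pairFactor (shiftBy J y) * S J (shiftBy J y) =
      (-1) ^ (J.card * (n - J.card)) * (pairFactor y * S J y) := by
  have hsign : ((-1) ^ (J.card * (n - J.card)) : ℂ) = ∏ j ∈ J, ∏ l ∈ Jᶜ, (-1 : ℂ) := by
    rw [Finset.prod_const, Finset.prod_const, Finset.card_compl, Fintype.card_fin, ← pow_mul,
      mul_comm]
  rw [hsign]
  unfold S pairFactor
  rw [prod_prod_compl_eq_prod_Ioi, prod_prod_compl_eq_prod_Ioi, prod_prod_compl_eq_prod_Ioi]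
  simp only [← Finset.prod_mul_distrib]
  refine Finset.prod_congr rfl fun i _ => Finset.prod_congr rfl fun j hj => ?_
  have hij : y i - y j ≠ 0 := sub_ne_zero.2 (hy.ne (Finset.mem_Ioi.1 hj).ne)
  have hpi : (Real.pi : ℂ) ≠ 0 := by exact_mod_cast Real.pi_ne_zero
  unfold shiftBy invGammaPair
  by_cases hi : i ∈ J <;> by_cases hj : j ∈ J
  · simp [hi, hj]
  · simp only [hi, hj, not_true_eq_false, not_false_eq_true, and_true, and_false, if_true, if_false,
      one_mul]
    have h1 : y i - 1 - y j ≠ 0 := sub_ne_zero.2 (h i j)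
    have h2 : (Real.pi : ℂ) * (y i - 1 - y j) = Real.pi * (y i - y j) - Real.pi := by ring
    rw [h2, Complex.sin_sub_pi]
    field_simp
  · simp only [hi, hj, not_true_eq_false, not_false_eq_true, and_true, and_false, if_true, if_false,
      mul_one]
    have h1 : y j - 1 - y i ≠ 0 := sub_ne_zero.2 (h j i)
    have h3 : y j - y i ≠ 0 := sub_ne_zero.2 (sub_ne_zero.1 hij).symm
    have h2 : (Real.pi : ℂ) * (y i - (y j - 1)) = Real.pi * (y i - y j) + Real.pi := by ring
    rw [h2, Complex.sin_add_pi]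
    field_simp
    ring
  · simp [hi, hj]

/-- Subtract `1` from the entries of row `m` with index in `J`. -/
def shiftRow {m : ℕ} (J : Finset (Fin m)) (z : (n : ℕ) → Fin n → ℂ) : (n : ℕ) → Fin n → ℂ :=
  Function.update z m (shiftBy J (z m))

theorem shiftRow_self {m : ℕ} (J : Finset (Fin m)) (z : (n : ℕ) → Fin n → ℂ) :
    shiftRow J z m = shiftBy J (z m) := Function.update_self _ _ _

theorem shiftRow_of_ne {m n : ℕ} (J : Finset (Fin m)) (z : (n : ℕ) → Fin n → ℂ) (h : n ≠ m) :
    shiftRow J z n = z n := Function.update_of_ne h _ _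

theorem sum_shiftRow {m : ℕ} (J : Finset (Fin m)) (z : (n : ℕ) → Fin n → ℂ) (n : ℕ) :
    ∑ j, shiftRow J z n j = ∑ j, z n j - if n = m then (J.card : ℂ) else 0 := by
  split_ifs with h
  · subst h
    rw [shiftRow_self]
    have : ∀ j, shiftBy J (z n) j = z n j - if j ∈ J then 1 else 0 := by
      intro j
      unfold shiftBy
      split_ifs <;> simp
    simp [this]
  · rw [shiftRow_of_ne _ _ h, sub_zero]

theorem linForm_shiftRow {N m : ℕ} (Q : ℕ → ℂ) (J : Finset (Fin (m + 1)))
    (z : (n : ℕ) → Fin n → ℂ) (hm : m < N) :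
    linForm N Q (shiftRow J z) = linForm N Q z - J.card * Q m +
      if m + 1 < N then J.card * Q (m + 1) else 0 := by
  unfold linForm
  simp only [sum_shiftRow]
  have h : ∀ n, Q n * (∑ j, z (n + 1) j - (if n + 1 = m + 1 then (J.card : ℂ) else 0) -
      (∑ j, z n j - if n = m + 1 then (J.card : ℂ) else 0)) =
      Q n * (∑ j, z (n + 1) j - ∑ j, z n j) - (if n = m then J.card * Q m else 0) +
        if n = m + 1 then J.card * Q (m + 1) else 0 := by
    intro n
    by_cases h1 : n = m
    · subst h1
      simp
      ring
    · by_cases h2 : n = m + 1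
      · subst h2
        simp
        ring
      · simp [h1, h2]
  simp only [h, Finset.sum_add_distrib, Finset.sum_sub_distrib, Finset.sum_ite_eq',
    Finset.mem_range, hm, if_true]

theorem core_shiftRow_top {M : ℕ} (Q : ℕ → ℂ) (I : Finset (Fin (M + 1)))
    (z : (n : ℕ) → Fin n → ℂ) (h : ∀ j k, z M j ≠ z (M + 1) k) :
    core (M + 1) Q (shiftRow I z) =
      Complex.exp (I.card * Q M) * (∏ i ∈ I, ∏ j, (z M j - z (M + 1) i)) * core (M + 1) Q z := by
  unfold core
  have hlin := linForm_shiftRow Q I z (Nat.lt_succ_self M)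
  rw [if_neg (lt_irrefl _), add_zero] at hlin
  rw [hlin, neg_sub, sub_eq_add_neg, Complex.exp_add, Finset.prod_range_succ,
    Finset.prod_range_succ]
  have hlow : ∏ n ∈ Finset.range M, gammaFactor (shiftRow I z n) (shiftRow I z (n + 1)) *
        pairFactor (shiftRow I z n) =
      ∏ n ∈ Finset.range M, gammaFactor (z n) (z (n + 1)) * pairFactor (z n) := by
    refine Finset.prod_congr rfl fun n hn => ?_
    have := Finset.mem_range.1 hn
    rw [shiftRow_of_ne _ _ (by omega), shiftRow_of_ne _ _ (by omega)]
  rw [hlow, shiftRow_of_ne _ _ (by omega : M ≠ M + 1), shiftRow_self,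
    gammaFactor_shiftBy_right _ _ _ h]
  ring

/-- The summand of the lower side of the duality at the rows `m` and `m + 1`. -/
def lowerTerm {m : ℕ} (J : Finset (Fin m)) (z : (n : ℕ) → Fin n → ℂ) : ℂ :=
  S J (z m) * ∏ j ∈ J, ∏ i, (z m j - z (m + 1) i)

/-- The summand of the upper side of the duality at the rows `m` and `m + 1`. -/
def upperTerm {m : ℕ} (I : Finset (Fin (m + 1))) (z : (n : ℕ) → Fin n → ℂ) : ℂ :=
  S I (z (m + 1)) * ∏ i ∈ I, ∏ j, (z (m + 1) i - z m j)

/-- A unit shift in row `m + 1` turns the lower terms for the rows `m + 1`, `m + 2` into upper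
terms for the rows `m`, `m + 1`. -/
theorem lowerTerm_mul_core_shiftRow {N m : ℕ} (Q : ℕ → ℂ) (J : Finset (Fin (m + 1)))
    (z : (n : ℕ) → Fin n → ℂ) (hm : m + 1 < N)
    (h1 : ∀ j k, z m j ≠ z (m + 1) k) (h2 : ∀ j k, z (m + 1) j - 1 ≠ z (m + 2) k)
    (h3 : Function.Injective (z (m + 1))) (h4 : ∀ j l, z (m + 1) j - 1 ≠ z (m + 1) l) :
    lowerTerm J (shiftRow J z) * core N Q (shiftRow J z) =
      Complex.exp (J.card * (Q m - Q (m + 1))) * (upperTerm J z * core N Q z) := by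
  obtain ⟨r, rfl⟩ := Nat.exists_eq_add_of_le (Nat.succ_le_of_lt hm)
  have hlin := linForm_shiftRow Q J z (Nat.lt_of_succ_lt hm)
  rw [if_pos hm] at hlin
  unfold core
  rw [hlin]
  have hexp : -(linForm ((m + 1).succ + r) Q z - J.card * Q m + J.card * Q (m + 1)) =
      J.card * (Q m - Q (m + 1)) + -linForm ((m + 1).succ + r) Q z := by ring
  rw [hexp, Complex.exp_add, Finset.prod_range_add, Finset.prod_range_add, Nat.succ_eq_add_one,
    Finset.prod_range_succ, Finset.prod_range_succ, Finset.prod_range_succ, Finset.prod_range_succ]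
  have hlow : ∏ n ∈ Finset.range m, gammaFactor (shiftRow J z n) (shiftRow J z (n + 1)) *
        pairFactor (shiftRow J z n) =
      ∏ n ∈ Finset.range m, gammaFactor (z n) (z (n + 1)) * pairFactor (z n) := by
    refine Finset.prod_congr rfl fun n hn => ?_
    have := Finset.mem_range.1 hn
    rw [shiftRow_of_ne _ _ (by omega), shiftRow_of_ne _ _ (by omega)]
  have hup : ∏ n ∈ Finset.range r, gammaFactor (shiftRow J z (m + 1 + 1 + n))
        (shiftRow J z (m + 1 + 1 + n + 1)) * pairFactor (shiftRow J z (m + 1 + 1 + n)) =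
      ∏ n ∈ Finset.range r, gammaFactor (z (m + 1 + 1 + n)) (z (m + 1 + 1 + n + 1)) *
        pairFactor (z (m + 1 + 1 + n)) := by
    refine Finset.prod_congr rfl fun n hn => ?_
    rw [shiftRow_of_ne _ _ (by omega), shiftRow_of_ne _ _ (by omega)]
  unfold lowerTerm upperTerm
  rw [hlow, hup, shiftRow_of_ne _ _ (by omega : m ≠ m + 1),
    shiftRow_of_ne _ _ (by omega : m + 1 + 1 ≠ m + 1), shiftRow_self,
    gammaFactor_shiftBy_right _ _ _ h1]
  have hS : ∏ j ∈ J, ∏ i, (shiftBy J (z (m + 1)) j - z (m + 1 + 1) i) =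
      ∏ j ∈ J, ∏ i, (z (m + 1) j - 1 - z (m + 1 + 1) i) := by
    refine Finset.prod_congr rfl fun j hj => ?_
    simp [shiftBy, hj]
  rw [hS, ← gammaFactor_shiftBy_left J _ _ h2]
  have hpair := pairFactor_shiftBy J _ h3 h4
  have hsign : ∏ i ∈ J, ∏ j, (z m j - z (m + 1) i) =
      (-1) ^ (J.card * m) * ∏ i ∈ J, ∏ j, (z (m + 1) i - z m j) := by
    have : ∀ i, ∏ j, (z m j - z (m + 1) i) = (-1) ^ m * ∏ j, (z (m + 1) i - z m j) := by
      intro i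
      rw [← Fin.prod_const, ← Finset.prod_mul_distrib]
      exact Finset.prod_congr rfl fun j _ => by ring
    simp only [this, Finset.prod_mul_distrib, Finset.prod_const, ← pow_mul]
    rw [mul_comm m]
  -- the total sign is `(-1) ^ (k (2 m + 1 - k))` with `k = |J|`, and this exponent is even
  have hone : ((-1) ^ (J.card * (m + 1 - J.card)) : ℂ) * (-1) ^ (J.card * m) = 1 := by
    have hle : J.card ≤ m + 1 := by simpa using Finset.card_le_univ J
    obtain ⟨d, hd⟩ := Nat.exists_eq_add_of_le hle
    have hsub : m + 1 - J.card = d := by omega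
    rw [← pow_add, hsub]
    refine Even.neg_one_pow ?_
    have hd' : d + J.card = m + 1 := by omega
    rcases Nat.even_or_odd J.card with he | ho
    · exact (he.mul_right _).add (he.mul_right _)
    · rw [← mul_add]
      refine Even.mul_left ?_ _
      rcases ho with ⟨t, ht⟩
      exact ⟨d + t, by omega⟩
  rw [hsign]
  linear_combination (Complex.exp (J.card * (Q m - Q (m + 1))) *
    Complex.exp (-linForm (m + 1 + 1 + r) Q z) *
    (∏ n ∈ Finset.range m, gammaFactor (z n) (z (n + 1)) * pairFactor (z n)) *
    (∏ n ∈ Finset.range r, gammaFactor (z (m + 1 + 1 + n)) (z (m + 1 + 1 + n + 1)) *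
      pairFactor (z (m + 1 + 1 + n))) * gammaFactor (z m) (z (m + 1)) * pairFactor (z m) *
    (∏ i ∈ J, ∏ j, (z (m + 1) i - z m j)) *
    gammaFactor (shiftBy J (z (m + 1))) (z (m + 1 + 1)) *
    (∏ j ∈ J, ∏ i, (z (m + 1) j - 1 - z (m + 1 + 1) i))) *
    ((-1) ^ (J.card * m) * hpair + pairFactor (z (m + 1)) * S J (z (m + 1)) * hone)

theorem sum_splitWeight_eq {n : ℕ} (x : Fin n → ℂ) (hx : Function.Injective x) (k : ℕ)
    (g : ℂ → ℂ) :
    ∑ I ∈ Finset.powersetCard k (Finset.univ : Finset (Fin n)), S I x * ∏ i ∈ I, g (x i) =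
      ∑ I ∈ Finset.powersetCard k (Finset.univ.map ⟨x, hx⟩),
        splitWeight (Finset.univ.map ⟨x, hx⟩) I * ∏ i ∈ I, g i := by
  rw [Finset.powersetCard_map, Finset.sum_map]
  refine Finset.sum_congr rfl fun I _ => ?_
  have h1 : Finset.univ.map ⟨x, hx⟩ \ I.map ⟨x, hx⟩ = Iᶜ.map ⟨x, hx⟩ := by
    rw [Finset.compl_eq_univ_sdiff, Finset.map_sdiff]
  simp [splitWeight, S, h1]

/-- The duality for two neighbouring rows. -/
theorem sum_upperTerm_eq {m k : ℕ} (z : (n : ℕ) → Fin n → ℂ) (hk : k ≤ m)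
    (hx : Function.Injective (z (m + 1))) (hy : Function.Injective (z m))
    (h : ∀ j k, z m j ≠ z (m + 1) k) :
    ∑ I ∈ Finset.powersetCard (k + 1) (Finset.univ : Finset (Fin (m + 1))), upperTerm I z =
      ∑ J ∈ Finset.powersetCard k (Finset.univ : Finset (Fin m)), lowerTerm J z := by
  have h1 := sum_splitWeight_eq _ hx (k + 1) (fun u => ∏ j, (u - z m j))
  have h2 := sum_splitWeight_eq _ hy k (fun u => ∏ i, (u - z (m + 1) i))
  unfold upperTerm lowerTerm
  rw [h1, h2]
  have h3 := upperSum_eq_lowerSum (X := Finset.univ.map ⟨z (m + 1), hx⟩)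
    (Y := Finset.univ.map ⟨z m, hy⟩) (k := k) ?_ (by simp) (by simpa using hk)
  · simpa [upperSum, lowerSum] using h3
  · rw [Finset.disjoint_left]
    intro u hu hu'
    obtain ⟨i, -, rfl⟩ := Finset.mem_map.1 hu
    obtain ⟨j, -, hj⟩ := Finset.mem_map.1 hu'
    exact h j i hj

/-! ### Decay and holomorphy of the integrand on tubes of contours -/

/-- The array `row`, with complex integration variables `w`. -/
def arr {N : ℕ} (lam : Fin N → ℂ) (w : Idx N → ℂ) (n : ℕ) (j : Fin n) : ℂ :=
  if h : n = N then lam (Fin.cast h j)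
  else if h' : n < N then w ⟨⟨n, h'⟩, j⟩
  else 0

theorem row_eq_arr {N : ℕ} (lam : Fin N → ℂ) (a x : Idx N → ℝ) :
    row lam a x = arr lam (onLine a x) := rfl

theorem arr_of_lt {N : ℕ} (lam : Fin N → ℂ) (w : Idx N → ℂ) {n : ℕ} (h : n < N) (j : Fin n) :
    arr lam w n j = w ⟨⟨n, h⟩, j⟩ := by
  simp [arr, h, h.ne]

theorem arr_top {N : ℕ} (lam : Fin N → ℂ) (w : Idx N → ℂ) (j : Fin N) :
    arr lam w N j = lam j := by
  simp [arr]

theorem arr_of_gt {N : ℕ} (lam : Fin N → ℂ) (w : Idx N → ℂ) {n : ℕ} (h : N < n) (j : Fin n) :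
    arr lam w n j = 0 := by
  simp [arr, h.ne', h.not_gt]

/-- The array `γ / (iħ)`. -/
def scaled (hbar : ℝ) {N : ℕ} (lam : Fin N → ℂ) (w : Idx N → ℂ) (n : ℕ) (j : Fin n) : ℂ :=
  arr lam w n j / (Complex.I * hbar)

/-- The imaginary parts of the array `γ`. -/
def height {N : ℕ} (lam : Fin N → ℂ) (a : Idx N → ℝ) (n : ℕ) (j : Fin n) : ℝ :=
  (row lam a 0 n j).im

section Height

variable {N : ℕ} {lam : Fin N → ℂ}

theorem height_of_lt (a : Idx N → ℝ) {n : ℕ} (h : n < N) (j : Fin n) :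
    height lam a n j = a ⟨⟨n, h⟩, j⟩ := by
  simp [height, row_eq_arr, arr_of_lt _ _ h, onLine]

theorem height_top (a : Idx N → ℝ) (j : Fin N) : height lam a N j = (lam j).im := by
  simp [height, row_eq_arr, arr_top]

theorem height_of_gt (a : Idx N → ℝ) {n : ℕ} (h : N < n) (j : Fin n) : height lam a n j = 0 := by
  simp [height, row_eq_arr, arr_of_gt _ _ h]

theorem arr_im (w : Idx N → ℂ) (n : ℕ) (j : Fin n) :
    (arr lam w n j).im = height lam (fun p => (w p).im) n j := by
  rcases lt_trichotomy n N with h | rfl | h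
  · rw [arr_of_lt _ _ h, height_of_lt _ h]
  · rw [arr_top, height_top]
  · rw [height_of_gt _ h, arr_of_gt _ _ h, Complex.zero_im]

theorem continuous_height (n : ℕ) (j : Fin n) :
    Continuous (fun a : Idx N → ℝ => height lam a n j) := by
  rcases lt_trichotomy n N with h | rfl | h
  · simp only [height_of_lt _ h]
    fun_prop
  · simp only [height_top]
    fun_prop
  · simp only [height_of_gt _ h]
    fun_prop

theorem height_convex {t u : ℝ} (htu : t + u = 1) (a b : Idx N → ℝ) {n : ℕ} (hn : n ≤ N)
    (j : Fin n) : height lam (t • a + u • b) n j = t * height lam a n j + u * height lam b n j := by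
  rcases hn.lt_or_eq with h | rfl
  · simp [height_of_lt _ h]
  · simp only [height_top, ← add_mul, htu, one_mul]

end Height

/-- Bounded admissible contours whose rows are at a distance more than `δ`. -/
def admSet {N : ℕ} (lam : Fin N → ℂ) (δ M : ℝ) : Set (Idx N → ℝ) :=
  {a | (∀ (n : Fin N) (j : Fin (n : ℕ)) (k : Fin ((n : ℕ) + 1)),
    height lam a ((n : ℕ) + 1) k + δ < height lam a n j) ∧ ∀ p, |a p| < M}

/-- Contours in `admSet` on which the entries of each row are ordered with gaps more than `δ`. -/
def ordSet {N : ℕ} (lam : Fin N → ℂ) (δ M : ℝ) : Set (Idx N → ℝ) :=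
  {a | a ∈ admSet lam δ M ∧
    ∀ (n : Fin N) (j l : Fin (n : ℕ)), j < l → a ⟨n, j⟩ + δ < a ⟨n, l⟩}

section Sets

variable {N : ℕ} {lam : Fin N → ℂ} {δ M : ℝ}

theorem isOpen_admSet : IsOpen (admSet lam δ M) := by
  unfold admSet
  simp only [Set.ofPred_and, Set.ofPred_forall]
  refine IsOpen.inter ?_ ?_
  · refine isOpen_iInter_of_finite fun n => isOpen_iInter_of_finite fun j =>
      isOpen_iInter_of_finite fun k => ?_
    exact isOpen_lt ((continuous_height _ _).add continuous_const) (continuous_height _ _)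
  · refine isOpen_iInter_of_finite fun p => ?_
    exact isOpen_lt (by fun_prop) continuous_const

theorem isOpen_ordSet : IsOpen (ordSet lam δ M) := by
  change IsOpen (admSet lam δ M ∩ {a | ∀ (n : Fin N) (j l : Fin (n : ℕ)), j < l →
    a ⟨n, j⟩ + δ < a ⟨n, l⟩})
  refine isOpen_admSet.inter ?_
  simp only [Set.ofPred_forall]
  refine isOpen_iInter_of_finite fun n => isOpen_iInter_of_finite fun j =>
    isOpen_iInter_of_finite fun l => isOpen_iInter_of_finite fun _ => ?_
  exact isOpen_lt (by fun_prop) (by fun_prop)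

theorem convexComb_add_lt {x y x' y' t u d : ℝ} (ht : 0 ≤ t) (hu : 0 ≤ u) (htu : t + u = 1)
    (h : x + d < y) (h' : x' + d < y') : t * x + u * x' + d < t * y + u * y' := by
  have h1 := (convex_Ioi (0 : ℝ)) (Set.mem_Ioi.2 (by linarith : 0 < y - x - d))
    (Set.mem_Ioi.2 (by linarith : 0 < y' - x' - d)) ht hu htu
  simp only [smul_eq_mul, Set.mem_Ioi] at h1
  have : d = t * d + u * d := by rw [← add_mul, htu, one_mul]
  linarith

theorem convex_admSet : Convex ℝ (admSet lam δ M) := by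
  intro a ha b hb t u ht hu htu
  refine ⟨fun n j k => ?_, fun p => ?_⟩
  · rw [height_convex htu _ _ n.isLt, height_convex htu _ _ n.isLt.le]
    exact convexComb_add_lt ht hu htu (ha.1 n j k) (hb.1 n j k)
  · have h1 := ha.2 p
    have h2 := hb.2 p
    have h3 : |t * a p + u * b p| ≤ t * |a p| + u * |b p| := by
      refine (abs_add_le _ _).trans_eq ?_
      rw [abs_mul, abs_mul, abs_of_nonneg ht, abs_of_nonneg hu]
    have h4 := convexComb_add_lt (d := 0) ht hu htu (by simpa using h1) (by simpa using h2)
    rw [add_zero, ← add_mul, htu, one_mul] at h4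
    simpa using h3.trans_lt h4

theorem convex_ordSet : Convex ℝ (ordSet lam δ M) := by
  intro a ha b hb t u ht hu htu
  refine ⟨convex_admSet ha.1 hb.1 ht hu htu, fun n j l hjl => ?_⟩
  simpa using convexComb_add_lt ht hu htu (ha.2 n j l hjl) (hb.2 n j l hjl)

end Sets

theorem differentiableAt_finsetProd {E κ : Type*} [NormedAddCommGroup E] [NormedSpace ℂ E]
    {u : Finset κ} {g : κ → E → ℂ} {x : E} (h : ∀ i ∈ u, DifferentiableAt ℂ (g i) x) :
    DifferentiableAt ℂ (fun w => ∏ i ∈ u, g i w) x := by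
  classical
  exact (HasFDerivAt.finsetProd fun i hi => (h i hi).hasFDerivAt).differentiableAt

section Decay

variable {hbar : ℝ} {N : ℕ} {lam : Fin N → ℂ} {δ M : ℝ}

theorem scaled_re (w : Idx N → ℂ) (n : ℕ) (j : Fin n) :
    (scaled hbar lam w n j).re = height lam (fun p => (w p).im) n j / hbar := by
  rw [← arr_im, scaled, mul_comm Complex.I, ← div_div, Complex.div_I]
  simp

theorem scaled_im (w : Idx N → ℂ) (n : ℕ) (j : Fin n) :
    (scaled hbar lam w n j).im = -((arr lam w n j).re / hbar) := by
  rw [scaled, mul_comm Complex.I, ← div_div, Complex.div_I]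
  simp

theorem differentiable_scaled (n : ℕ) (j : Fin n) :
    Differentiable ℂ (fun w : Idx N → ℂ => scaled hbar lam w n j) := by
  have h : Differentiable ℂ (fun w : Idx N → ℂ => arr lam w n j) := by
    rcases lt_trichotomy n N with h | rfl | h
    · simp only [arr_of_lt _ _ h]
      fun_prop
    · simp only [arr_top]
      fun_prop
    · simp only [arr_of_gt _ _ h]
      fun_prop
  intro w
  have hw := h w
  unfold scaled
  fun_prop

theorem abs_height_le {a : Idx N → ℝ} (ha : ∀ p, |a p| < M) {n : ℕ} (hn : n ≤ N) (j : Fin n) :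
    |height lam a n j| ≤ |M| + ∑ i, ‖lam i‖ := by
  have h0 : 0 ≤ ∑ i, ‖lam i‖ := Finset.sum_nonneg fun _ _ => norm_nonneg _
  rcases hn.lt_or_eq with h | rfl
  · rw [height_of_lt _ h]
    have := (ha ⟨⟨n, h⟩, j⟩).le.trans (le_abs_self M)
    linarith
  · rw [height_top]
    have h1 := Finset.single_le_sum (f := fun i => ‖lam i‖) (fun _ _ => norm_nonneg _)
      (Finset.mem_univ j)
    have h2 := Complex.abs_im_le_norm (lam j)
    have h3 := abs_nonneg M
    linarith

theorem linGrowth_scaled (hpos : 0 < hbar) {s : Set (Idx N → ℝ)} (hs : s ⊆ admSet lam δ M) {n : ℕ}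
    (hn : n ≤ N) (j : Fin n) : LinGrowth (tube s) (fun w => scaled hbar lam w n j) := by
  have h0 : 0 ≤ ∑ i, ‖lam i‖ := Finset.sum_nonneg fun _ _ => norm_nonneg _
  refine ⟨(1 + |M| + ∑ i, ‖lam i‖) / hbar, by positivity, fun w hw => ?_⟩
  have hν : 0 ≤ ∑ p, |(w p).re| := Finset.sum_nonneg fun _ _ => abs_nonneg _
  have hden : ‖(Complex.I * hbar : ℂ)‖ = hbar := by simp [abs_of_pos hpos]
  simp only [scaled]
  rw [norm_div, hden, div_mul_eq_mul_div]
  refine div_le_div_of_nonneg_right ?_ hpos.le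
  have hL : 1 + |M| + ∑ i, ‖lam i‖ + ∑ p, |(w p).re| ≤
      (1 + |M| + ∑ i, ‖lam i‖) * (1 + ∑ p, |(w p).re|) := by
    have : 0 ≤ (|M| + ∑ i, ‖lam i‖) * ∑ p, |(w p).re| := by positivity
    linarith
  refine le_trans ?_ hL
  have hM := abs_nonneg M
  rcases hn.lt_or_eq with h | rfl
  · rw [arr_of_lt _ _ h]
    have h1 := Complex.norm_le_abs_re_add_abs_im (w ⟨⟨n, h⟩, j⟩)
    have h2 := ((hs hw).2 ⟨⟨n, h⟩, j⟩).le.trans (le_abs_self M)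
    have h3 := Finset.single_le_sum (f := fun p => |(w p).re|) (fun _ _ => abs_nonneg _)
      (Finset.mem_univ ⟨⟨n, h⟩, j⟩)
    linarith
  · rw [arr_top]
    have h1 := Finset.single_le_sum (f := fun i => ‖lam i‖) (fun _ _ => norm_nonneg _)
      (Finset.mem_univ j)
    linarith

theorem scaled_sub_re_bounds (hpos : 0 < hbar) {w : Idx N → ℂ} (hw : w ∈ tube (admSet lam δ M))
    {n : ℕ} (hn : n < N) (j : Fin n) (k : Fin (n + 1)) :
    δ / hbar ≤ (scaled hbar lam w n j - scaled hbar lam w (n + 1) k).re ∧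
      (scaled hbar lam w n j - scaled hbar lam w (n + 1) k).re ≤
        2 * (|M| + ∑ i, ‖lam i‖) / hbar := by
  rw [Complex.sub_re, scaled_re, scaled_re, ← sub_div]
  have h1 := hw.1 ⟨n, hn⟩ j k
  have h2 := (abs_le.1 (abs_height_le (lam := lam) hw.2 hn.le j)).2
  have h3 := (abs_le.1 (abs_height_le (lam := lam) hw.2 (Nat.succ_le_of_lt hn) k)).1
  simp only at h1
  constructor
  · refine div_le_div_of_nonneg_right ?_ hpos.le
    linarith
  · refine div_le_div_of_nonneg_right ?_ hpos.le
    linarith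

theorem differentiableOn_core (hpos : 0 < hbar) (hδ : 0 < δ) (Q : ℕ → ℂ) :
    DifferentiableOn ℂ (fun w => core N Q (scaled hbar lam w)) (tube (admSet lam δ M)) := by
  intro w hw
  refine DifferentiableAt.differentiableWithinAt ?_
  have hz : ∀ n (j : Fin n), DifferentiableAt ℂ (fun w : Idx N → ℂ => scaled hbar lam w n j) w :=
    fun n j => (differentiable_scaled n j).differentiableAt
  unfold core linForm gammaFactor pairFactor invGammaPair
  refine DifferentiableAt.fun_mul ?_ ?_
  · fun_prop
  · refine differentiableAt_finsetProd fun n hn => ?_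
    refine DifferentiableAt.fun_mul ?_ ?_
    · refine differentiableAt_finsetProd fun j _ => differentiableAt_finsetProd fun k _ => ?_
      have hre := (scaled_sub_re_bounds hpos hw (Finset.mem_range.1 hn) j k).1
      have hpos' : 0 < δ / hbar := by positivity
      refine DifferentiableAt.comp (g := Complex.Gamma) w
        (Complex.differentiableAt_Gamma _ fun m h => ?_) ((hz _ _).sub (hz _ _))
      rw [h] at hre
      have : (0 : ℝ) ≤ m := m.cast_nonneg
      simp at hre
      linarith
    · refine differentiableAt_finsetProd fun j _ => differentiableAt_finsetProd fun k _ => ?_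
      fun_prop

theorem re_neg_linForm_le (hpos : 0 < hbar) {w : Idx N → ℂ} (hw : w ∈ tube (admSet lam δ M))
    (Q : ℕ → ℂ) :
    (-linForm N Q (scaled hbar lam w)).re ≤
      ∑ n : Fin N, (Q n).im * (∑ j, (scaled hbar lam w ((n : ℕ) + 1) j).im -
          ∑ j, (scaled hbar lam w (n : ℕ) j).im) +
        ∑ n : Fin N, |(Q n).re| * ((2 * N) * ((|M| + ∑ i, ‖lam i‖) / hbar)) := by
  unfold linForm
  rw [← Finset.sum_add_distrib, ← Fin.sum_univ_eq_sum_range (fun n => Q n *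
    (∑ j, scaled hbar lam w (n + 1) j - ∑ j, scaled hbar lam w n j)), ← Finset.sum_neg_distrib,
    Complex.re_sum]
  refine Finset.sum_le_sum fun n _ => ?_
  set B := (|M| + ∑ i, ‖lam i‖) / hbar with hB
  have hre : ∀ n ≤ N, |(∑ j, scaled hbar lam w n j).re| ≤ N * B := by
    intro n hn
    rw [Complex.re_sum]
    refine (Finset.abs_sum_le_sum_abs _ _).trans ?_
    have h0 : 0 ≤ ∑ i, ‖lam i‖ := Finset.sum_nonneg fun _ _ => norm_nonneg _
    have hB0 : 0 ≤ B := by positivity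
    refine (Finset.sum_le_card_nsmul _ _ B fun j _ => ?_).trans ?_
    · rw [scaled_re, abs_div, abs_of_pos hpos]
      exact div_le_div_of_nonneg_right (abs_height_le hw.2 hn j) hpos.le
    · rw [Finset.card_univ, Fintype.card_fin, nsmul_eq_mul]
      exact mul_le_mul_of_nonneg_right (by exact_mod_cast hn) hB0
  have h1 := hre _ n.isLt.le
  have h2 := hre _ (Nat.succ_le_of_lt n.isLt)
  have h3 : |(∑ j, scaled hbar lam w ((n : ℕ) + 1) j - ∑ j, scaled hbar lam w (n : ℕ) j).re| ≤
      2 * N * B := by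
    rw [Complex.sub_re]
    refine (abs_sub _ _).trans ?_
    linarith
  rw [Complex.neg_re, Complex.mul_re, Complex.sub_im, Complex.im_sum, Complex.im_sum]
  have h4 := mul_le_mul_of_nonneg_left h3 (abs_nonneg (Q n).re)
  rw [← abs_mul] at h4
  have h5 := neg_abs_le ((Q n).re *
    (∑ j, scaled hbar lam w ((n : ℕ) + 1) j - ∑ j, scaled hbar lam w (n : ℕ) j).re)
  linarith

/-- The integrand, multiplied by a function of subexponential growth, decays exponentially. -/
theorem expDecay_mul_core (hpos : 0 < hbar) (hδ : 0 < δ) {Q : ℕ → ℂ}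
    (hQ : ∀ i j : Fin N, |(Q i).im - (Q j).im| < Real.pi) {s : Set (Idx N → ℝ)}
    (hs : s ⊆ admSet lam δ M) {R : (Idx N → ℂ) → ℂ} (hR : ExpType (tube s) R (fun _ => 0)) :
    ExpDecay s (fun w => R w * core N Q (scaled hbar lam w)) := by
  have hst : tube s ⊆ tube (admSet lam δ M) := fun w hw => hs hw
  have hsub : ∀ n ≤ N, ∀ m ≤ N, ∀ (j : Fin n) (k : Fin m),
      LinGrowth (tube s) (fun w => scaled hbar lam w n j - scaled hbar lam w m k) :=
    fun n hn m hm j k => (linGrowth_scaled hpos hs hn j).sub (linGrowth_scaled hpos hs hm k)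
  have hprod : ExpType (tube s) (fun w => ∏ n ∈ Finset.range N,
      gammaFactor (scaled hbar lam w n) (scaled hbar lam w (n + 1)) *
        pairFactor (scaled hbar lam w n))
      (fun w => ∑ n ∈ Finset.range N, (∑ j, ∑ k, -(Real.pi / 2) *
          |(scaled hbar lam w n j - scaled hbar lam w (n + 1) k).im| +
        ∑ j, ∑ k ∈ Finset.Ioi j, Real.pi *
          |(scaled hbar lam w n j - scaled hbar lam w n k).im|)) := by
    refine ExpType.prod _ fun n hn => ?_
    have hn := Finset.mem_range.1 hn
    refine ExpType.mul ?_ ?_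
    · refine ExpType.prod _ fun j _ => ExpType.prod _ fun k _ => ?_
      exact (hsub n hn.le (n + 1) hn j k).expType_Gamma (by positivity : 0 < δ / hbar)
        fun w hw => scaled_sub_re_bounds hpos (hst hw) hn j k
    · refine ExpType.prod _ fun j _ => ExpType.prod _ fun k _ => ?_
      exact (hsub n hn.le n hn.le j k).expType_sin
  have htype := hR.mul ((expType_exp (T := tube s)
    (f := fun w => -linForm N Q (scaled hbar lam w))).mul hprod)
  obtain ⟨K, c, hc, hK⟩ := exists_exponent_le (fun n : Fin N => (Q n).im) hQ
    ((∑ i, ‖lam i‖) / hbar)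
  refine ExpType.expDecay (K := K + ∑ n : Fin N, |(Q n).re| *
    ((2 * N) * ((|M| + ∑ i, ‖lam i‖) / hbar))) (c := c / hbar) htype (by positivity)
    fun w hw => ?_
  have h1 := hK (fun n j => (scaled hbar lam w n j).im) ?_
  · have h2 := re_neg_linForm_le hpos (hst hw) Q
    have h3 : ∑ n : Fin N, ∑ j, |(scaled hbar lam w (n : ℕ) j).im| =
        (∑ p, |(w p).re|) / hbar := by
      rw [Fintype.sum_sigma, Finset.sum_div]
      refine Finset.sum_congr rfl fun n _ => ?_
      rw [Finset.sum_div]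
      refine Finset.sum_congr rfl fun j _ => ?_
      rw [scaled_im, arr_of_lt _ _ n.isLt, abs_neg, abs_div, abs_of_pos hpos]
    rw [h3] at h1
    simp only [Complex.sub_im, ← Finset.mul_sum]
    have h4 : c / hbar * ∑ p, |(w p).re| = c * ((∑ p, |(w p).re|) / hbar) := by ring
    rw [h4]
    linarith
  · intro j
    rw [scaled_im, arr_top, abs_neg, abs_div, abs_of_pos hpos]
    refine div_le_div_of_nonneg_right ((Complex.abs_re_le_norm _).trans ?_) hpos.le
    exact Finset.single_le_sum (f := fun i => ‖lam i‖) (fun _ _ => norm_nonneg _)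
      (Finset.mem_univ j)

end Decay

/-! ### Spaced contours and the telescoping of the difference operator -/

/-- Contours with gaps of at least `2ħ` between neighbouring rows and between the entries of each
row. Lowering some of the entries by `ħ` keeps them admissible, and no denominator
`γ_{nj} - γ_{nk}` vanishes on the way. -/
def Spaced (hbar : ℝ) {N : ℕ} (lam : Fin N → ℂ) (a : Idx N → ℝ) : Prop :=
  (∀ (n : Fin N) (j : Fin (n : ℕ)) (k : Fin ((n : ℕ) + 1)),
    height lam a ((n : ℕ) + 1) k + 2 * hbar ≤ height lam a n j) ∧
  ∀ (n : Fin N) (j l : Fin (n : ℕ)), j < l → a ⟨n, j⟩ + 2 * hbar ≤ a ⟨n, l⟩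

/-- A contour that is spaced for `λ`: entries in a row have gaps `2ħ`, so that a row extends over
less than `2Nħ`, and the rows start at distances `4Nħ`. -/
def spacedContour (hbar : ℝ) {N : ℕ} (lam : Fin N → ℂ) (p : Idx N) : ℝ :=
  (∑ i, ‖lam i‖) + hbar * (4 * N * ((N : ℝ) - (p.1 : ℕ)) + 2 * (p.2 : ℕ))

theorem spaced_spacedContour {hbar : ℝ} (hpos : 0 < hbar) {N : ℕ} (lam : Fin N → ℂ) :
    Spaced hbar lam (spacedContour hbar lam) := by
  refine ⟨fun n j k => ?_, fun n j l hjl => ?_⟩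
  · rw [height_of_lt _ n.isLt]
    have hj : (0 : ℝ) ≤ (j : ℕ) := Nat.cast_nonneg _
    have hn : ((n : ℕ) : ℝ) + 1 ≤ N := by exact_mod_cast n.isLt
    have hk : ((k : ℕ) : ℝ) ≤ (n : ℕ) := by exact_mod_cast Nat.lt_succ_iff.1 k.isLt
    have hn0 : (0 : ℝ) ≤ (n : ℕ) := Nat.cast_nonneg _
    rcases (Nat.succ_le_of_lt n.isLt).lt_or_eq with h | h
    · rw [height_of_lt _ h]
      simp only [spacedContour]
      push_cast
      nlinarith
    · have hk' : height lam (spacedContour hbar lam) ((n : ℕ) + 1) k ≤ ∑ i, ‖lam i‖ := by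
        obtain ⟨i, hi⟩ : ∃ i, height lam (spacedContour hbar lam) ((n : ℕ) + 1) k = (lam i).im :=
          ⟨Fin.cast h k, by
            have h' : (n : ℕ) + 1 = N := h
            simp [height, row, h']⟩
        rw [hi]
        refine ((le_abs_self _).trans (Complex.abs_im_le_norm _)).trans ?_
        exact Finset.single_le_sum (f := fun i => ‖lam i‖) (fun _ _ => norm_nonneg _)
          (Finset.mem_univ i)
      simp only [spacedContour]
      have h1 : (1 : ℝ) * 4 ≤ 4 * N * ((N : ℝ) - (n : ℕ)) := by nlinarith
      nlinarith
  · have hjl' : ((j : ℕ) : ℝ) + 1 ≤ (l : ℕ) := by exact_mod_cast hjl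
    simp only [spacedContour]
    nlinarith

section Telescope

variable {hbar : ℝ} {N : ℕ} {lam : Fin N → ℂ} {a : Idx N → ℝ}

theorem Spaced.exists_mem_ordSet (hpos : 0 < hbar) (ha : Spaced hbar lam a) :
    ∃ M : ℝ, ∀ b : Idx N → ℝ, (∀ p, a p - hbar ≤ b p ∧ b p ≤ a p) →
      b ∈ ordSet lam (hbar / 2) M := by
  have h0 : ∀ p, |a p| ≤ ∑ p, |a p| := fun p =>
    Finset.single_le_sum (f := fun p => |a p|) (fun _ _ => abs_nonneg _) (Finset.mem_univ p)
  refine ⟨(∑ p, |a p|) + 2 * hbar, fun b hb => ?_⟩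
  have hh : ∀ n ≤ N, ∀ j : Fin n, height lam a n j - hbar ≤ height lam b n j ∧
      height lam b n j ≤ height lam a n j := by
    intro n hn j
    rcases hn.lt_or_eq with h | rfl
    · rw [height_of_lt _ h, height_of_lt _ h]
      exact hb _
    · rw [height_top, height_top]
      constructor <;> linarith
  refine ⟨⟨fun n j k => ?_, fun p => ?_⟩, fun n j l hjl => ?_⟩
  · have h1 := ha.1 n j k
    have h2 := (hh _ (Nat.succ_le_of_lt n.isLt) k).2
    have h3 := (hh _ n.isLt.le j).1
    simp only [Nat.succ_eq_add_one] at h2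
    linarith
  · have h1 := hb p
    have h2 := abs_le.1 (h0 p)
    rw [abs_lt]
    constructor <;> linarith
  · have h1 := ha.2 n j l hjl
    have h2 := (hb ⟨n, j⟩).2
    have h3 := (hb ⟨n, l⟩).1
    linarith

/-- The contour with the entries of row `m` with index in `J` lowered by `ħ`. -/
def lowerContour (hbar : ℝ) {N m : ℕ} (J : Finset (Fin m)) (a : Idx N → ℝ) (p : Idx N) : ℝ :=
  if (p.1 : ℕ) = m ∧ (p.2 : ℕ) ∈ J.map Fin.valEmbedding then a p - hbar else a p

theorem scaled_lowerContour (hpos : 0 < hbar) {m : ℕ} (hm : m < N) (J : Finset (Fin m))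
    (x : Idx N → ℝ) :
    scaled hbar lam (onLine (lowerContour hbar J a) x) =
      shiftRow J (scaled hbar lam (onLine a x)) := by
  have hh : (hbar : ℂ) ≠ 0 := by exact_mod_cast hpos.ne'
  funext n j
  by_cases hn : n = m
  · subst hn
    rw [shiftRow_self]
    simp only [scaled, shiftBy, arr_of_lt _ _ hm, onLine, lowerContour]
    have hmem : (j : ℕ) ∈ J.map Fin.valEmbedding ↔ j ∈ J := by
      rw [Finset.mem_map]
      constructor
      · rintro ⟨i, hi, hij⟩
        rwa [← Fin.ext hij]
      · intro hj
        exact ⟨j, hj, rfl⟩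
    simp only [hmem, true_and]
    split_ifs
    · push_cast
      field_simp
      ring
    · rfl
  · rw [shiftRow_of_ne _ _ hn]
    unfold scaled
    congr 1
    rcases lt_trichotomy n N with h | rfl | h
    · rw [arr_of_lt _ _ h, arr_of_lt _ _ h]
      simp [onLine, lowerContour, hn]
    · rw [arr_top, arr_top]
    · rw [arr_of_gt _ _ h, arr_of_gt _ _ h]

theorem scaled_shift_lam (hpos : 0 < hbar) (I : Finset (Fin N)) (w : Idx N → ℂ) :
    scaled hbar (fun i => if i ∈ I then lam i - Complex.I * hbar else lam i) w =
      shiftRow I (scaled hbar lam w) := by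
  have hh : (hbar : ℂ) ≠ 0 := by exact_mod_cast hpos.ne'
  funext n j
  by_cases hn : n = N
  · subst hn
    rw [shiftRow_self]
    simp only [scaled, shiftBy, arr_top]
    split_ifs
    · field_simp
    · rfl
  · rw [shiftRow_of_ne _ _ hn]
    simp [scaled, arr, hn]

theorem lowerTerm_expType (hpos : 0 < hbar) {δ M : ℝ} (hδ : 0 < δ) {m : ℕ} (hm : m < N)
    (J : Finset (Fin m)) :
    ExpType (tube (ordSet lam δ M)) (fun w => lowerTerm J (scaled hbar lam w)) (fun _ => 0) := by
  have hs : ordSet lam δ M ⊆ admSet lam δ M := fun a ha => ha.1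
  have h1 : ExpType (tube (ordSet lam δ M)) (fun w => S J (scaled hbar lam w m))
      (fun _ => ∑ j ∈ J, ∑ l ∈ Jᶜ, 0) := by
    refine ExpType.prod _ fun j hj => ExpType.prod _ fun l hl => ?_
    refine ExpType.of_bound (C := 1 / (δ / hbar)) fun w hw => ?_
    rw [norm_div, norm_one]
    refine one_div_le_one_div_of_le (by positivity) ?_
    refine le_trans ?_ (Complex.abs_re_le_norm _)
    rw [Complex.sub_re, scaled_re, scaled_re, ← sub_div, abs_div, abs_of_pos hpos,
      height_of_lt _ hm, height_of_lt _ hm]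
    refine div_le_div_of_nonneg_right ?_ hpos.le
    have hjl : j ≠ l := fun h => Finset.mem_compl.1 hl (h ▸ hj)
    rcases hjl.lt_or_gt with h | h
    · have := hw.2 ⟨m, hm⟩ j l h
      rw [abs_sub_comm]
      refine le_trans ?_ (le_abs_self _)
      linarith
    · have := hw.2 ⟨m, hm⟩ l j h
      refine le_trans ?_ (le_abs_self _)
      linarith
  have h2 : ExpType (tube (ordSet lam δ M))
      (fun w => ∏ j ∈ J, ∏ i, (scaled hbar lam w m j - scaled hbar lam w (m + 1) i))
      (fun _ => ∑ j ∈ J, ∑ i : Fin (m + 1), 0) := by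
    refine ExpType.prod _ fun j _ => ExpType.prod _ fun i _ => ?_
    exact ((linGrowth_scaled hpos hs hm.le j).sub (linGrowth_scaled hpos hs hm i)).expType
  simpa [lowerTerm] using h1.mul h2

theorem lowerTerm_differentiableOn (hpos : 0 < hbar) {δ M : ℝ} (hδ : 0 < δ) {m : ℕ} (hm : m < N)
    (J : Finset (Fin m)) :
    DifferentiableOn ℂ (fun w => lowerTerm J (scaled hbar lam w)) (tube (ordSet lam δ M)) := by
  intro w hw
  refine DifferentiableAt.differentiableWithinAt ?_
  have hz : ∀ n (j : Fin n), DifferentiableAt ℂ (fun w : Idx N → ℂ => scaled hbar lam w n j) w :=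
    fun n j => (differentiable_scaled n j).differentiableAt
  unfold lowerTerm S
  refine DifferentiableAt.fun_mul ?_ ?_
  · refine differentiableAt_finsetProd fun j hj => differentiableAt_finsetProd fun l hl => ?_
    have hne : scaled hbar lam w m j - scaled hbar lam w m l ≠ 0 := by
      intro h
      have h1 := congrArg Complex.re h
      rw [Complex.sub_re, scaled_re, scaled_re, height_of_lt _ hm, height_of_lt _ hm, ← sub_div,
        Complex.zero_re, div_eq_zero_iff] at h1
      have h1 := h1.resolve_right hpos.ne'
      have hjl : j ≠ l := fun h => Finset.mem_compl.1 hl (h ▸ hj)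
      rcases hjl.lt_or_gt with h | h
      · have := hw.2 ⟨m, hm⟩ j l h
        linarith
      · have := hw.2 ⟨m, hm⟩ l j h
        linarith
    have h1 := (hz m j).fun_sub (hz m l)
    fun_prop (disch := assumption)
  · refine differentiableAt_finsetProd fun j hj => differentiableAt_finsetProd fun l hl => ?_
    exact (hz _ _).fun_sub (hz _ _)

/-- The integrand on a contour. -/
def coreOnLine (hbar : ℝ) {N : ℕ} (lam : Fin N → ℂ) (Q : ℕ → ℂ) (a x : Idx N → ℝ) : ℂ :=
  core N Q (scaled hbar lam (onLine a x))

theorem scaled_onLine_re (x : Idx N → ℝ) (n : ℕ) (j : Fin n) :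
    (scaled hbar lam (onLine a x) n j).re = height lam a n j / hbar := by
  rw [scaled_re]
  simp [onLine]

theorem Spaced.rows_ne (hpos : 0 < hbar) (ha : Spaced hbar lam a) (x : Idx N → ℝ) {n : ℕ}
    (hn : n < N) (j : Fin n) (k : Fin (n + 1)) :
    scaled hbar lam (onLine a x) n j - 1 ≠ scaled hbar lam (onLine a x) (n + 1) k ∧
      scaled hbar lam (onLine a x) n j ≠ scaled hbar lam (onLine a x) (n + 1) k := by
  have h1 := ha.1 ⟨n, hn⟩ j k
  simp only at h1
  constructor <;> intro h <;> have h2 := congrArg Complex.re h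
  · rw [Complex.sub_re, scaled_onLine_re, scaled_onLine_re, Complex.one_re] at h2
    field_simp at h2
    linarith
  · rw [scaled_onLine_re, scaled_onLine_re] at h2
    field_simp at h2
    linarith

theorem Spaced.row_ne (hpos : 0 < hbar) (ha : Spaced hbar lam a) (x : Idx N → ℝ) {n : ℕ}
    (hn : n < N) (j l : Fin n) :
    scaled hbar lam (onLine a x) n j - 1 ≠ scaled hbar lam (onLine a x) n l := by
  intro h
  have h2 := congrArg Complex.re h
  rw [Complex.sub_re, scaled_onLine_re, scaled_onLine_re, Complex.one_re, height_of_lt _ hn,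
    height_of_lt _ hn] at h2
  field_simp at h2
  rcases lt_trichotomy j l with h3 | rfl | h3
  · have := ha.2 ⟨n, hn⟩ j l h3
    linarith
  · linarith
  · have := ha.2 ⟨n, hn⟩ l j h3
    linarith

theorem Spaced.row_injective (hpos : 0 < hbar) (ha : Spaced hbar lam a) (x : Idx N → ℝ) {n : ℕ}
    (hn : n < N) : Function.Injective (scaled hbar lam (onLine a x) n) := by
  intro j l h
  have h2 := congrArg Complex.re h
  rw [scaled_onLine_re, scaled_onLine_re, height_of_lt _ hn, height_of_lt _ hn] at h2
  field_simp at h2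
  rcases lt_trichotomy j l with h3 | h3 | h3
  · have := ha.2 ⟨n, hn⟩ j l h3
    linarith
  · exact h3
  · have := ha.2 ⟨n, hn⟩ l j h3
    linarith

theorem scaled_top_injective (hpos : 0 < hbar) (hlam : Function.Injective lam) (w : Idx N → ℂ) :
    Function.Injective (scaled hbar lam w N) := by
  intro i j h
  have hh : (Complex.I * hbar : ℂ) ≠ 0 := by
    have : (hbar : ℂ) ≠ 0 := by exact_mod_cast hpos.ne'
    simp [this]
  simp only [scaled, arr_top] at h
  exact hlam ((div_left_inj' hh).1 h)

variable {Q : ℕ → ℂ}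

/-- The integrals of the lower terms are moved to the contour lowered by `ħ` in the entries `J` of
row `m + 1`, where they become upper terms of the next pair of rows. -/
theorem Spaced.integral_lowerTerm (hpos : 0 < hbar) (ha : Spaced hbar lam a)
    (hQ : ∀ i j : Fin N, |(Q i).im - (Q j).im| < Real.pi) {m : ℕ} (hm : m + 1 < N)
    (J : Finset (Fin (m + 1))) :
    (Integrable fun x => lowerTerm J (scaled hbar lam (onLine a x)) * coreOnLine hbar lam Q a x) ∧
    (Integrable fun x => upperTerm J (scaled hbar lam (onLine a x)) * coreOnLine hbar lam Q a x) ∧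
    ∫ x, lowerTerm J (scaled hbar lam (onLine a x)) * coreOnLine hbar lam Q a x =
      Complex.exp (J.card * (Q m - Q (m + 1))) *
        ∫ x, upperTerm J (scaled hbar lam (onLine a x)) * coreOnLine hbar lam Q a x := by
  obtain ⟨M, hM⟩ := ha.exists_mem_ordSet hpos
  have hδ : 0 < hbar / 2 := half_pos hpos
  have ha1 : a ∈ ordSet lam (hbar / 2) M := hM a fun p => ⟨by linarith, le_rfl⟩
  have ha2 : lowerContour hbar J a ∈ ordSet lam (hbar / 2) M := by
    refine hM _ fun p => ?_
    unfold lowerContour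
    split_ifs <;> constructor <;> linarith
  have hs : ordSet lam (hbar / 2) M ⊆ admSet lam (hbar / 2) M := fun a ha => ha.1
  have hst : tube (ordSet lam (hbar / 2) M) ⊆ tube (admSet lam (hbar / 2) M) := fun w hw => hs hw
  have hdiff : DifferentiableOn ℂ (fun w => lowerTerm J (scaled hbar lam w) *
      core N Q (scaled hbar lam w)) (tube (ordSet lam (hbar / 2) M)) :=
    (lowerTerm_differentiableOn hpos hδ hm J).fun_mul ((differentiableOn_core hpos hδ Q).mono hst)
  have hdec := expDecay_mul_core hpos hδ hQ hs
    (lowerTerm_expType (lam := lam) (M := M) hpos hδ hm J)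
  have hshift : ∀ x, lowerTerm J (scaled hbar lam (onLine (lowerContour hbar J a) x)) *
      core N Q (scaled hbar lam (onLine (lowerContour hbar J a) x)) =
      Complex.exp (J.card * (Q m - Q (m + 1))) *
        (upperTerm J (scaled hbar lam (onLine a x)) * coreOnLine hbar lam Q a x) := by
    intro x
    rw [scaled_lowerContour hpos hm]
    exact lowerTerm_mul_core_shiftRow Q J _ hm
      (fun j k => (ha.rows_ne hpos x (Nat.lt_of_succ_lt hm) j k).2)
      (fun j k => (ha.rows_ne hpos x hm j k).1) (ha.row_injective hpos x hm)
      (ha.row_ne hpos x hm)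
  have hI1 := integrable_onLine hdiff.continuousOn hdec ha1
  have hI2 := integrable_onLine hdiff.continuousOn hdec ha2
  have hE := integral_onLine_eq isOpen_ordSet convex_ordSet hdiff hdec ha1 ha2
  simp only [hshift] at hI2 hE
  refine ⟨hI1, ?_, ?_⟩
  · refine (hI2.const_mul (Complex.exp (J.card * (Q m - Q (m + 1))))⁻¹).congr
      (Filter.Eventually.of_forall fun x => ?_)
    simp only
    rw [← mul_assoc, inv_mul_cancel₀ (Complex.exp_ne_zero _), one_mul]
  · rw [← integral_const_mul]
    exact hE

/-- Row by row, the duality and the shift of the contour lower both the rows and the size of the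
subsets, until only the empty subset is left. -/
theorem Spaced.integral_sum_upperTerm (hpos : 0 < hbar) (ha : Spaced hbar lam a)
    (hQ : ∀ i j : Fin N, |(Q i).im - (Q j).im| < Real.pi) (hlam : Function.Injective lam) (k : ℕ) :
    ∀ m, m < N → k ≤ m + 1 →
      ∫ x, (∑ I ∈ Finset.powersetCard k (Finset.univ : Finset (Fin (m + 1))),
        upperTerm I (scaled hbar lam (onLine a x))) * coreOnLine hbar lam Q a x =
      Complex.exp (∑ n ∈ Finset.Ico (m + 1 - k) (m + 1), Q n - k * Q m) *
        ∫ x, coreOnLine hbar lam Q a x := by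
  induction k with
  | zero =>
    intro m _ _
    simp [upperTerm, S]
  | succ k ih =>
    intro m hm hk
    have hdual : ∀ x, ∑ I ∈ Finset.powersetCard (k + 1) (Finset.univ : Finset (Fin (m + 1))),
        upperTerm I (scaled hbar lam (onLine a x)) =
        ∑ J ∈ Finset.powersetCard k (Finset.univ : Finset (Fin m)),
          lowerTerm J (scaled hbar lam (onLine a x)) := by
      intro x
      refine sum_upperTerm_eq _ (by omega) ?_ (ha.row_injective hpos x hm)
        fun j k => (ha.rows_ne hpos x hm j k).2
      rcases (Nat.succ_le_of_lt hm).lt_or_eq with h | h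
      · exact ha.row_injective hpos x h
      · subst h
        exact scaled_top_injective hpos hlam _
    simp only [hdual]
    rcases m with _ | m
    · obtain rfl : k = 0 := by omega
      simp [lowerTerm, S]
    · have hint := fun J => ha.integral_lowerTerm hpos hQ hm J
      simp only [Finset.sum_mul]
      rw [integral_finsetSum _ fun J _ => (hint J).1]
      have hterm : ∀ J ∈ Finset.powersetCard k (Finset.univ : Finset (Fin (m + 1))),
          ∫ x, lowerTerm J (scaled hbar lam (onLine a x)) * coreOnLine hbar lam Q a x =
          Complex.exp (k * (Q m - Q (m + 1))) *
            ∫ x, upperTerm J (scaled hbar lam (onLine a x)) * coreOnLine hbar lam Q a x := by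
        intro J hJ
        rw [(hint J).2.2, (Finset.mem_powersetCard.1 hJ).2]
      rw [Finset.sum_congr rfl hterm, ← Finset.mul_sum,
        ← integral_finsetSum _ fun J _ => (hint J).2.1]
      simp only [← Finset.sum_mul]
      rw [ih m (by omega) (by omega), ← mul_assoc, ← Complex.exp_add]
      congr 2
      have h1 : m + 1 + 1 - (k + 1) = m + 1 - k := by omega
      rw [h1, Finset.sum_Ico_succ_top (by omega : m + 1 - k ≤ m + 1)]
      push_cast
      ring

end Telescope

/-! ### The powers of `c` and the difference equation -/

/-- The parameters `q_n + (2n - N - 1) log c`, with `n` counted from `0`, for which the powers of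
`c` in the integrand disappear. -/
def twist (c : ℂ) {N : ℕ} (q : Fin N → ℂ) (n : ℕ) : ℂ :=
  (if h : n < N then q ⟨n, h⟩ else 0) + (2 * n + 1 - N) * Complex.log c

theorem twist_coe (c : ℂ) {N : ℕ} (q : Fin N → ℂ) (n : Fin N) :
    twist c q n = q n + (2 * (n : ℕ) + 1 - N) * Complex.log c := by
  simp [twist]

theorem prod_prod_cpow {c : ℂ} (hc : c ≠ 0) {n : ℕ} (y : Fin n → ℂ) (x : Fin (n + 1) → ℂ) :
    ∏ j, ∏ k, c ^ (y j - x k) =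
      Complex.exp (Complex.log c * ((n + 1) * ∑ j, y j - n * ∑ k, x k)) := by
  simp only [Complex.cpow_def_of_ne_zero hc, ← Complex.exp_sum, ← Finset.mul_sum]
  congr 2
  simp only [Finset.sum_sub_distrib, Finset.sum_const, Finset.card_univ, Fintype.card_fin,
    nsmul_eq_mul, ← Finset.mul_sum]
  push_cast
  ring

/-- The total exponent of `c` is linear in the row sums `s n`. -/
theorem sum_range_exponent (N : ℕ) (s : ℕ → ℂ) (hs : s 0 = 0) :
    ∑ n ∈ Finset.range N, ((n + 1) * s n - n * s (n + 1)) =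
      -∑ n ∈ Finset.range N, (2 * n + 1 - N) * (s (n + 1) - s n) := by
  rw [eq_neg_iff_add_eq_zero, ← Finset.sum_add_distrib]
  have h : ∀ n : ℕ, ((n : ℂ) + 1) * s n - n * s (n + 1) +
      (2 * n + 1 - N) * (s (n + 1) - s n) =
      (N - (n : ℕ)) * s n - (N - ((n + 1 : ℕ) : ℂ)) * s (n + 1) := by
    intro n
    push_cast
    ring
  rw [Finset.sum_congr rfl fun n _ => h n,
    Finset.sum_range_sub' (fun n : ℕ => ((N : ℂ) - n) * s n)]
  simp [hs]

theorem integrand_eq_core {c : ℂ} (hc : c ≠ 0) (hbar : ℝ) {N : ℕ} (q : Fin N → ℂ)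
    (γ : (n : ℕ) → Fin n → ℂ) :
    integrand c hbar q γ =
      core N (twist c q) (fun n j => γ n j / (Complex.I * hbar)) := by
  set z : (n : ℕ) → Fin n → ℂ := fun n j => γ n j / (Complex.I * hbar) with hz
  have hrow : ∀ n ∈ Finset.range N,
      (∏ j : Fin n, ∏ k : Fin (n + 1), c ^ ((γ n j - γ (n + 1) k) / (Complex.I * hbar)) *
        Complex.Gamma ((γ n j - γ (n + 1) k) / (Complex.I * hbar))) /
      (∏ j : Fin n, ∏ k ∈ Finset.Ioi j,
          Complex.Gamma ((γ n j - γ n k) / (Complex.I * hbar)) *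
            Complex.Gamma (-((γ n j - γ n k) / (Complex.I * hbar)))) =
      Complex.exp (Complex.log c * ((n + 1) * ∑ j, z n j - n * ∑ k, z (n + 1) k)) *
        (gammaFactor (z n) (z (n + 1)) * pairFactor (z n)) := by
    intro n _
    rw [← prod_prod_cpow hc, div_eq_mul_inv]
    simp only [← Finset.prod_inv_distrib, inv_Gamma_mul_Gamma_neg]
    simp only [Finset.prod_mul_distrib, sub_div, gammaFactor, pairFactor, hz, mul_assoc]
  have hIco : ∀ f : ℕ → ℂ, f 0 = 1 → ∏ n ∈ Finset.Ico 1 N, f n = ∏ n ∈ Finset.range N, f n := by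
    intro f hf
    refine Finset.prod_subset (fun n hn => ?_) fun n hn hn' => ?_
    · exact Finset.mem_range.2 (Finset.mem_Ico.1 hn).2
    · have : n = 0 := by
        rw [Finset.mem_Ico] at hn'
        rw [Finset.mem_range] at hn
        omega
      rw [this, hf]
  unfold integrand core
  rw [hIco _ (by simp), Finset.prod_congr rfl hrow, Finset.prod_mul_distrib, ← Complex.exp_sum,
    ← mul_assoc, ← Complex.exp_add, ← Finset.mul_sum,
    sum_range_exponent N (fun n => ∑ j, z n j) (by simp)]
  congr 2
  unfold linForm twist
  rw [← Fin.sum_univ_eq_sum_range (fun n : ℕ => (2 * (n : ℂ) + 1 - N) *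
      (∑ j, z (n + 1) j - ∑ j, z n j)),
    ← Fin.sum_univ_eq_sum_range (fun n : ℕ => ((if h : n < N then q ⟨n, h⟩ else 0) +
      (2 * (n : ℂ) + 1 - N) * Complex.log c) * (∑ j, z (n + 1) j - ∑ j, z n j)),
    neg_mul, mul_neg, ← neg_add, Finset.mul_sum, Finset.mul_sum, ← Finset.sum_add_distrib]
  congr 1
  refine Finset.sum_congr rfl fun n _ => ?_
  simp only [n.isLt, dif_pos, Fin.eta, hz, ← Finset.sum_div]
  ring

section Main

variable {c : ℂ} {hbar : ℝ} {N : ℕ} {q : Fin N → ℂ}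

theorem lineIntegrand_eq (hc : c ≠ 0) (lam : Fin N → ℂ) (a x : Idx N → ℝ) :
    lineIntegrand c hbar lam q a x = coreOnLine hbar lam (twist c q) a x :=
  integrand_eq_core hc hbar q _

theorem Admissible.exists_mem_admSet {lam : Fin N → ℂ} {a b : Idx N → ℝ} (ha : Admissible lam a)
    (hb : Admissible lam b) :
    ∃ δ M : ℝ, 0 < δ ∧ a ∈ admSet lam δ M ∧ b ∈ admSet lam δ M := by
  have hgap : ∀ a : Idx N → ℝ, Admissible lam a → ∃ δ : ℝ, 0 < δ ∧
      ∀ (n : Fin N) (j : Fin (n : ℕ)) (k : Fin ((n : ℕ) + 1)),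
        height lam a ((n : ℕ) + 1) k + δ < height lam a n j := by
    intro a ha
    let ι := (n : Fin N) × Fin (n : ℕ) × Fin ((n : ℕ) + 1)
    rcases isEmpty_or_nonempty ι with h | h
    · exact ⟨1, one_pos, fun n j k => (h.false ⟨n, j, k⟩).elim⟩
    · obtain ⟨⟨n₀, j₀, k₀⟩, h₀⟩ := Finite.exists_min (fun i : ι =>
        height lam a i.1 i.2.1 - height lam a ((i.1 : ℕ) + 1) i.2.2)
      have h1 := ha n₀ j₀ k₀
      refine ⟨(height lam a n₀ j₀ - height lam a ((n₀ : ℕ) + 1) k₀) / 2, ?_, fun n j k => ?_⟩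
      · unfold height
        linarith
      · have h2 := h₀ ⟨n, j, k⟩
        simp only at h2
        unfold height at h2 ⊢
        linarith
  obtain ⟨δ, hδ, h1⟩ := hgap a ha
  obtain ⟨ε, hε, h2⟩ := hgap b hb
  have hbd : ∀ a : Idx N → ℝ, ∀ p, |a p| ≤ ∑ p, |a p| := fun a p =>
    Finset.single_le_sum (f := fun p => |a p|) (fun _ _ => abs_nonneg _) (Finset.mem_univ p)
  have h0 : ∀ a : Idx N → ℝ, 0 ≤ ∑ p, |a p| := fun a => Finset.sum_nonneg fun _ _ => abs_nonneg _
  refine ⟨min δ ε, (∑ p, |a p|) + (∑ p, |b p|) + 1, lt_min hδ hε, ⟨fun n j k => ?_, fun p => ?_⟩,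
    ⟨fun n j k => ?_, fun p => ?_⟩⟩
  · have := h1 n j k
    have := min_le_left δ ε
    linarith
  · have := hbd a p
    have := h0 b
    linarith
  · have := h2 n j k
    have := min_le_right δ ε
    linarith
  · have := hbd b p
    have := h0 a
    linarith

theorem integrable_and_integral_eq (hpos : 0 < hbar) {Q : ℕ → ℂ}
    (hQ : ∀ i j : Fin N, |(Q i).im - (Q j).im| < Real.pi) {lam : Fin N → ℂ} {a b : Idx N → ℝ}
    (ha : Admissible lam a) (hb : Admissible lam b) :
    Integrable (coreOnLine hbar lam Q a) ∧
      ∫ x, coreOnLine hbar lam Q a x = ∫ x, coreOnLine hbar lam Q b x := by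
  obtain ⟨δ, M, hδ, ha', hb'⟩ := ha.exists_mem_admSet hb
  have hdiff := differentiableOn_core (N := N) (lam := lam) (M := M) hpos hδ Q
  have hdec : ExpDecay (admSet lam δ M) (fun w => core N Q (scaled hbar lam w)) := by
    have := expDecay_mul_core (lam := lam) (M := M) hpos hδ hQ (Set.Subset.refl _)
      (R := fun _ => 1) (ExpType.of_bound (C := 1) (by simp))
    simpa using this
  exact ⟨integrable_onLine hdiff.continuousOn hdec ha',
    integral_onLine_eq isOpen_admSet convex_admSet hdiff hdec ha' hb'⟩

theorem lineIntegrand_integrable_and_integral_eq (hpos : 0 < hbar) (hc : c ≠ 0)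
    (hQ : ∀ i j : Fin N, |(twist c q i).im - (twist c q j).im| < Real.pi) {lam : Fin N → ℂ}
    {a : Idx N → ℝ} (ha : Admissible lam a) :
    Integrable (lineIntegrand c hbar lam q a) ∧
      ∫ x, lineIntegrand c hbar lam q a x = whittaker c hbar lam q := by
  have h : ∀ a, lineIntegrand c hbar lam q a = coreOnLine hbar lam (twist c q) a :=
    fun a => funext fun x => lineIntegrand_eq hc lam a x
  unfold whittaker
  rw [h, h]
  exact integrable_and_integral_eq hpos hQ ha (stdContour_admissible lam)

theorem Spaced.admissible (hpos : 0 < hbar) {lam : Fin N → ℂ} {a : Idx N → ℝ}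
    (ha : Spaced hbar lam a) (I : Finset (Fin N)) :
    Admissible (fun i => if i ∈ I then lam i - Complex.I * hbar else lam i) a := by
  intro n j k
  have h1 := ha.1 n j k
  change height _ a _ k < height _ a _ j
  rw [height_of_lt _ n.isLt] at h1 ⊢
  refine lt_of_le_of_lt ?_ (lt_of_lt_of_le (lt_add_of_pos_right _ (by linarith)) h1)
  rcases (Nat.succ_le_of_lt n.isLt).lt_or_eq with h | h
  · rw [height_of_lt _ h, height_of_lt _ h]
  · have h' : (n : ℕ) + 1 = N := h
    simp only [height, row, h', dif_pos]
    split_ifs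
    · simp [hpos.le]
    · exact le_rfl

theorem Spaced.admissible_self (hpos : 0 < hbar) {lam : Fin N → ℂ} {a : Idx N → ℝ}
    (ha : Spaced hbar lam a) : Admissible lam a := by
  simpa using ha.admissible hpos ∅

theorem S_div (I : Finset (Fin N)) (lam : Fin N → ℂ) {d : ℂ} (hd : d ≠ 0) :
    S I lam = (d ^ (I.card * (N - I.card)))⁻¹ * S I (fun i => lam i / d) := by
  have h : (d ^ (I.card * (N - I.card)))⁻¹ = ∏ i ∈ I, ∏ j ∈ Iᶜ, d⁻¹ := by
    rw [Finset.prod_const, Finset.prod_const, Finset.card_compl, Fintype.card_fin, ← pow_mul,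
      mul_comm, inv_pow]
  rw [h]
  unfold S
  simp only [← Finset.prod_mul_distrib]
  refine Finset.prod_congr rfl fun i _ => Finset.prod_congr rfl fun j _ => ?_
  rw [← sub_div]
  field_simp

theorem sum_twist (c : ℂ) (q : Fin N → ℂ) {k : ℕ} (hk : k ≤ N) :
    ∑ n ∈ Finset.Ico (N - k) N, twist c q n =
      ∑ n ∈ Finset.univ.filter (fun n : Fin N => N ≤ (n : ℕ) + k), q n +
        (k * (N - k) : ℕ) * Complex.log c := by
  have hlog : ∀ k ≤ N, ∑ n ∈ Finset.Ico (N - k) N, (2 * (n : ℂ) + 1 - N) = (k * (N - k) : ℕ) := by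
    intro k
    induction k with
    | zero => simp
    | succ k ih =>
      intro hk
      have h1 : N - (k + 1) + 1 = N - k := by omega
      rw [Finset.sum_eq_sum_Ico_succ_bot (by omega), h1, ih (by omega)]
      push_cast [Nat.cast_sub hk, Nat.cast_sub (Nat.le_of_succ_le hk)]
      ring
  unfold twist
  rw [Finset.sum_add_distrib, ← Finset.sum_mul, hlog k hk]
  congr 1
  have h1 : Finset.Ico (N - k) N = (Finset.univ.filter
      (fun n : Fin N => N ≤ (n : ℕ) + k)).map Fin.valEmbedding := by
    ext n
    simp only [Finset.mem_Ico, Finset.mem_map, Finset.mem_filter, Finset.mem_univ, true_and,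
      Fin.valEmbedding_apply]
    constructor
    · rintro ⟨h1, h2⟩
      exact ⟨⟨n, h2⟩, by simp only; omega, rfl⟩
    · rintro ⟨i, h1, rfl⟩
      have := i.isLt
      omega
  rw [h1, Finset.sum_map]
  refine Finset.sum_congr rfl fun n _ => ?_
  simp

/-- The difference equation for general `c`. -/
theorem Xstar_whittaker (hpos : 0 < hbar) (hc : c ≠ 0)
    (hQ : ∀ i j : Fin N, |(twist c q i).im - (twist c q j).im| < Real.pi) {k : ℕ} (hk1 : 1 ≤ k)
    (hk : k ≤ N) {lam : Fin N → ℂ} (hlam : Function.Injective lam) :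
    Xstar hbar k (fun l => whittaker c hbar l q) lam =
      ((Complex.I * hbar) ^ (k * (N - k)))⁻¹ * c ^ (k * (N - k)) * (-1) ^ (k * (N - 1)) *
        Complex.exp (∑ n ∈ Finset.univ.filter (fun n : Fin N => N ≤ (n : ℕ) + k), q n) *
          whittaker c hbar lam q := by
  obtain ⟨M, rfl⟩ : ∃ M, N = M + 1 := ⟨N - 1, by omega⟩
  have hd : (Complex.I * hbar : ℂ) ≠ 0 := by
    have : (hbar : ℂ) ≠ 0 := by exact_mod_cast hpos.ne'
    simp [this]
  set a := spacedContour hbar lam with haa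
  have ha : Spaced hbar lam a := spaced_spacedContour hpos lam
  set Q := twist c q with hQdef
  have hW : ∀ l, Admissible l a → whittaker c hbar l q = ∫ x, coreOnLine hbar l Q a x := by
    intro l hl
    rw [← (lineIntegrand_integrable_and_integral_eq hpos hc hQ hl).2]
    exact integral_congr_ae (Filter.Eventually.of_forall fun x => lineIntegrand_eq hc l a x)
  have hshift : ∀ I ∈ Finset.powersetCard k (Finset.univ : Finset (Fin (M + 1))), ∀ x,
      S I lam * coreOnLine hbar (fun i => if i ∈ I then lam i - Complex.I * hbar else lam i) Q a x =
      ((Complex.I * hbar) ^ (k * (M + 1 - k)))⁻¹ * (-1) ^ (k * M) * Complex.exp (k * Q M) *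
        (upperTerm I (scaled hbar lam (onLine a x)) * coreOnLine hbar lam Q a x) := by
    intro I hI x
    have hcard := (Finset.mem_powersetCard.1 hI).2
    unfold coreOnLine
    rw [scaled_shift_lam hpos, core_shiftRow_top Q I _
      (fun j k => (ha.rows_ne hpos x (Nat.lt_succ_self M) j k).2), hcard, S_div I lam hd, hcard]
    have hsign : ∏ i ∈ I, ∏ j, (scaled hbar lam (onLine a x) M j -
          scaled hbar lam (onLine a x) (M + 1) i) =
        (-1) ^ (k * M) * ∏ i ∈ I, ∏ j, (scaled hbar lam (onLine a x) (M + 1) i -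
          scaled hbar lam (onLine a x) M j) := by
      have : ∀ i, ∏ j, (scaled hbar lam (onLine a x) M j -
          scaled hbar lam (onLine a x) (M + 1) i) =
          (-1) ^ M * ∏ j, (scaled hbar lam (onLine a x) (M + 1) i -
            scaled hbar lam (onLine a x) M j) := by
        intro i
        rw [← Fin.prod_const, ← Finset.prod_mul_distrib]
        exact Finset.prod_congr rfl fun j _ => by ring
      simp only [this, Finset.prod_mul_distrib, Finset.prod_const, ← pow_mul, hcard]
      rw [mul_comm M]
    have htop : (fun i => lam i / (Complex.I * hbar)) = scaled hbar lam (onLine a x) (M + 1) := by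
      funext i
      rw [scaled, arr_top]
    rw [hsign, htop, upperTerm]
    ring
  have hint : ∀ I ∈ Finset.powersetCard k (Finset.univ : Finset (Fin (M + 1))),
      Integrable fun x => ((Complex.I * hbar) ^ (k * (M + 1 - k)))⁻¹ * (-1) ^ (k * M) *
        Complex.exp (k * Q M) *
          (upperTerm I (scaled hbar lam (onLine a x)) * coreOnLine hbar lam Q a x) := by
    intro I hI
    have h1 := (integrable_and_integral_eq hpos hQ (ha.admissible hpos I)
      (ha.admissible hpos I)).1.const_mul (S I lam)
    simpa only [hshift I hI] using h1
  have hX : Xstar hbar k (fun l => whittaker c hbar l q) lam =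
      ∫ x, ((Complex.I * hbar) ^ (k * (M + 1 - k)))⁻¹ * (-1) ^ (k * M) * Complex.exp (k * Q M) *
        ((∑ I ∈ Finset.powersetCard k (Finset.univ : Finset (Fin (M + 1))),
          upperTerm I (scaled hbar lam (onLine a x))) * coreOnLine hbar lam Q a x) := by
    simp only [Finset.sum_mul, Finset.mul_sum]
    rw [integral_finsetSum _ hint]
    unfold Xstar
    refine Finset.sum_congr rfl fun I hI => ?_
    unfold muStar
    beta_reduce
    rw [hW _ (ha.admissible hpos I), ← integral_const_mul]
    simp only [hshift I hI]
  rw [hX, integral_const_mul, ha.integral_sum_upperTerm hpos hQ hlam k M (Nat.lt_succ_self M) hk,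
    hW lam (ha.admissible_self hpos), sum_twist c q hk, Nat.add_sub_cancel]
  have hexp : Complex.exp (∑ n ∈ Finset.univ.filter (fun n : Fin (M + 1) => M + 1 ≤ (n : ℕ) + k),
        q n + (k * (M + 1 - k) : ℕ) * Complex.log c - k * Q M) =
      Complex.exp (∑ n ∈ Finset.univ.filter (fun n : Fin (M + 1) => M + 1 ≤ (n : ℕ) + k), q n) *
        c ^ (k * (M + 1 - k)) * Complex.exp (-(k * Q M)) := by
    rw [sub_eq_add_neg, Complex.exp_add, Complex.exp_add, Complex.exp_nat_mul, Complex.exp_log hc]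
  rw [hexp, Complex.exp_neg]
  have := Complex.exp_ne_zero (k * Q M)
  field_simp

end Main

end WhittakerDual

end

theorem mainTheorem1 (N : ℕ) (hbar : ℝ) (hpos : 0 < hbar) :
    -- powers of `iħ` in the integrand
    (∀ q : Fin N → ℂ,
      (∀ i j : Fin N, |(q i - q j).im + Real.pi * (((i : ℕ) : ℝ) - ((j : ℕ) : ℝ))| < Real.pi) →
      (∀ (lam : Fin N → ℂ) (a : WhittakerDual.Idx N → ℝ), WhittakerDual.Admissible lam a →
        MeasureTheory.Integrable
          (WhittakerDual.lineIntegrand (Complex.I * hbar) hbar lam q a) ∧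
        ∫ x, WhittakerDual.lineIntegrand (Complex.I * hbar) hbar lam q a x =
          WhittakerDual.whittaker (Complex.I * hbar) hbar lam q) ∧
      ∀ k : ℕ, 1 ≤ k → k ≤ N → ∀ lam : Fin N → ℂ, Function.Injective lam →
        WhittakerDual.Xstar hbar k
            (fun l => WhittakerDual.whittaker (Complex.I * hbar) hbar l q) lam =
          (-1) ^ (k * (N - 1)) *
            Complex.exp (∑ n ∈ Finset.univ.filter (fun n : Fin N => N ≤ (n : ℕ) + k), q n) *
            WhittakerDual.whittaker (Complex.I * hbar) hbar lam q) ∧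
    -- powers of `ħ` in the integrand; this part contains all real `q`
    (∀ q : Fin N → ℂ,
      (∀ i j : Fin N, |(q i - q j).im| < Real.pi) →
      (∀ (lam : Fin N → ℂ) (a : WhittakerDual.Idx N → ℝ), WhittakerDual.Admissible lam a →
        MeasureTheory.Integrable
          (WhittakerDual.lineIntegrand (hbar : ℂ) hbar lam q a) ∧
        ∫ x, WhittakerDual.lineIntegrand (hbar : ℂ) hbar lam q a x =
          WhittakerDual.whittaker (hbar : ℂ) hbar lam q) ∧
      ∀ k : ℕ, 1 ≤ k → k ≤ N → ∀ lam : Fin N → ℂ, Function.Injective lam →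
        WhittakerDual.Xstar hbar k
            (fun l => WhittakerDual.whittaker (hbar : ℂ) hbar l q) lam =
          Complex.I ^ (k * (N - k)) *
            Complex.exp (∑ n ∈ Finset.univ.filter (fun n : Fin N => N ≤ (n : ℕ) + k), q n) *
            WhittakerDual.whittaker (hbar : ℂ) hbar lam q) := by
  have hh : (hbar : ℂ) ≠ 0 := by exact_mod_cast hpos.ne'
  have hIh : (Complex.I * hbar : ℂ) ≠ 0 := mul_ne_zero Complex.I_ne_zero hh
  have harg : (Complex.log (Complex.I * hbar)).im = Real.pi / 2 := by
    rw [Complex.log_im, mul_comm, Complex.arg_real_mul _ hpos, Complex.arg_I]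
  have harg' : (Complex.log (hbar : ℂ)).im = 0 := by
    rw [Complex.log_im, Complex.arg_ofReal_of_nonneg hpos.le]
  have htw : ∀ (c : ℂ) (q : Fin N → ℂ) (n : Fin N), (WhittakerDual.twist c q n).im =
      (q n).im + (2 * ((n : ℕ) : ℝ) + 1 - N) * (Complex.log c).im := by
    intro c q n
    rw [WhittakerDual.twist_coe, Complex.add_im]
    congr 1
    have : (2 * ((n : ℕ) : ℂ) + 1 - N) = ((2 * ((n : ℕ) : ℝ) + 1 - N : ℝ) : ℂ) := by push_cast; ring
    rw [this, Complex.im_ofReal_mul]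
  refine ⟨fun q hq => ?_, fun q hq => ?_⟩
  · have hQ : ∀ i j : Fin N, |(WhittakerDual.twist (Complex.I * hbar) q i).im -
        (WhittakerDual.twist (Complex.I * hbar) q j).im| < Real.pi := by
      intro i j
      rw [htw, htw, harg]
      convert hq i j using 2
      rw [Complex.sub_im]
      ring
    refine ⟨fun lam a ha =>
      WhittakerDual.lineIntegrand_integrable_and_integral_eq hpos hIh hQ ha,
      fun k hk1 hk lam hlam => ?_⟩
    rw [WhittakerDual.Xstar_whittaker hpos hIh hQ hk1 hk hlam,
      inv_mul_cancel₀ (pow_ne_zero _ hIh), one_mul]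
  · have hQ : ∀ i j : Fin N, |(WhittakerDual.twist (hbar : ℂ) q i).im -
        (WhittakerDual.twist (hbar : ℂ) q j).im| < Real.pi := by
      intro i j
      rw [htw, htw, harg', mul_zero, mul_zero, add_zero, add_zero, ← Complex.sub_im]
      exact hq i j
    refine ⟨fun lam a ha =>
      WhittakerDual.lineIntegrand_integrable_and_integral_eq hpos hh hQ ha,
      fun k hk1 hk lam hlam => ?_⟩
    rw [WhittakerDual.Xstar_whittaker hpos hh hQ hk1 hk hlam]
    congr 2
    -- `i ^ (-d) (-1) ^ (k (N - 1)) = i ^ d` because `d = k (N - k)` has the parity of `k (N - 1)`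
    have hsign : ((-1) ^ (k * (N - 1)) : ℂ) =
        Complex.I ^ (k * (N - k)) * Complex.I ^ (k * (N - k)) := by
      rw [← mul_pow, Complex.I_mul_I]
      obtain ⟨d, rfl⟩ := Nat.exists_eq_add_of_le hk
      obtain ⟨e, rfl⟩ := Nat.exists_eq_add_of_le hk1
      have h1 : (1 + e) * (1 + e + d - 1) = (1 + e) * (1 + e + d - (1 + e)) + e * (e + 1) := by
        have h2 : 1 + e + d - 1 = e + d := by omega
        have h3 : 1 + e + d - (1 + e) = d := by omega
        rw [h2, h3]
        ring
      rw [h1, pow_add, (Nat.even_mul_succ_self e).neg_one_pow, mul_one]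
    rw [hsign, mul_pow]
    have := pow_ne_zero (k * (N - k)) Complex.I_ne_zero
    have := pow_ne_zero (k * (N - k)) hh
    field_simp
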